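/- **Setting.** Let $(M,d)$ be a metric space with a nonzero Borel measure $\mu$, $B(x,r)=\{y: d(x,y)\le r\}$, $V_x(r)=\mu(B(x,r))$. Assume that for each $x\in M$ the function $V_x$ is finite and continuous in $r$ (with $V_x(0)=0$, i.e. points have measure zero). Let $\beta>1$, $1/\beta+1/\beta'=1$, $p\ge1$, $A_0>0$, $A_\infty\ge0$. Negative powers of $0$ are read as $+\infty$. A measurable $k:M\times M\to\mathbb R$ is a *Riesz-like kernel* of order $\beta$ with normalization constants $A_0,A_\infty$ if there is $B\ge 0$ such that for all $x,y$ - (K1) $\int_{r_1\le d(x,y)\le r_2}|k(x,y)|^\beta d\mu(y)\le A_0\log\frac{V_x(r_2)}{V_x(r_1)}+B$ if $0<V_x(r_1)<V_x(r_2)\le1$; - (K2) the same with $A_\infty$ in place of $A_0$ if $1\le V_x(r_1)<V_x(r_2)$; - (K3) $|k(x,y)|\le B\,V_x(d(x,y))^{-1/\beta}$ and $|k(x,y)|\le B\,V_y(d(x,y))^{-1/\beta}$; and - (K4) for each $\delta>0$ there is $B_\delta$ with $\int_{d(x,y)>R}|k(x',y)-k(x,y)|^\beta d\mu(y)\le B_\delta$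 whenever $V_x(R)\ge(1+\delta)V_x(r)$ and $x'\in B(x,r)$. Assume that $k$ is Riesz-like; or, alternatively, that $A_\infty=0$ and that (K1), (K2), the first estimate of (K3) for $V_x(d(x,y))\le1$, (K4) for $V_x(r)\le 1$, and $\sup_x (k(x,\cdot))^*(t)\le Ct^{-1/\beta}$, $\sup_y (k(\cdot,y))^*(t)\le Ct^{-1/\beta}$ for $t>0$ hold (${}^*$ is the decreasing rearrangement). Let $Tf(x)=\int_M k(x,y)f(y)\,d\mu(y)$ and $\exp_N(t)=e^t-\sum_{i=0}^N t^i/i!$. Consider, for measurable $f$ supported in a ball, the inequalities $$\text{(1)}\quad \int_M \frac{\exp_{\lceil p/\beta-1\rceil}\big[\tfrac{1}{\max\{A_0,A_\infty\}}|Tf|^\beta\big]}{1+|Tf|^{p\beta/\beta'}}d\mu\le C\|Tf\|_p^p \quad\text{under } \|f\|_{\beta'}\le1,$$ $$\text{(2)}\quad \int_M \frac{\exp_{\lceil p/\beta-1\rceil}\big[\tfrac1{A_0}|Tf|^\beta\big]}{1+|Tf|^{p\beta/\beta'}}d\mu\le C\|Tf\|_p^p,\qquad \text{(3)}\quad \int_M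 \exp_{\lceil \beta'-2\rceil}\big[\tfrac1{A_0}|Tf|^\beta\big]d\mu\le C,$$ the last two under $\|f\|_{\beta'}^{\beta'}+\kappa\|Tf\|_{\beta'}^{\beta'}\le1$, where $\kappa\ge0$ (for $\kappa=0$ this is $\|f\|_{\beta'}\le 1$). **Regularity at a point.** Let $x_0\in M$ and suppose: (i) for some $\eta_1>0$ and each $\delta>0$ there is $C_\delta$ with $|k(x',y)-k(x_0,y)|\le C_\delta V_{x_0}(d(x_0,x'))^{\eta_1}V_{x_0}(d(x_0,y))^{-\eta_1-1/\beta}$ whenever $V_{x_0}(R)\ge(1+\delta)V_{x_0}(r)$, $x'\in B(x_0,r)$, $y\notin B(x_0,R)$; (ii) $k$ has a Taylor formula with volume remainder of order $\eta\ge0$ in $y$ at $x_0$: there are $m\ge1$ and measurable $k_j,p_j$ on $M$ ($0\le j<m$), the $p_j$ bounded on each ball $B(x_0,r)$ and linearly independent in $L^2(B(x_0,r))$ if $V_{x_0}(r)>0$, such that for each $\delta>0$ there is $C_\delta$ with $$\Big|k(x,y)-\sum_{j<m}k_j(x)p_j(y)\Big|\le C_\delta V_{x_0}(d(y,x_0))^{\eta}V_{x_0}(d(x,x_0))^{-\eta-1/\beta}$$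 whenever $V_{x_0}(R)\ge(1+\delta)V_{x_0}(r)$, $d(y,x_0)\le r$, $d(x,x_0)\ge R$; and there is $C$ such that, for every $r$ with $V_{x_0}(r)>0$, every $L^2(B(x_0,r))$-orthonormal basis $v_0,\dots,v_{m-1}$ of the span of the $p_j$ satisfies $|v_j|\le C\,V_{x_0}(r)^{-1/2}$ on $B(x_0,r)$. **Theorem.** Suppose $p>(1+p/\beta')(1+\eta)^{-1}$. (a) Suppose $k$ is proper on the diagonal at $x_0$: for some $C$, $\int_{r_1\le d(x_0,y)\le r_2}|k(x_0,y)|^\beta d\mu(y)\ge A_0\log\frac{V_{x_0}(r_2)}{V_{x_0}(r_1)}-C$ whenever $0<V_{x_0}(r_1)<V_{x_0}(r_2)\le1$. If $A_0\ge A_\infty$, then in (1) the exponential constant $1/A_0$ and the power $p\beta/\beta'$ of the denominator are sharp. For each $\kappa\ge0$, provided $\kappa=0$ or $\beta'>2(1+\eta)^{-1}$ (which is automatic if $p\le\beta'$), the exponential constant $1/A_0$ in (2) and in (3) and the power $p\beta/\beta'$ in (2) are sharp. Moreover, if the exponential constant in (1) (when $A_0\ge A_\infty$) or in (2) is replaced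 by any larger one, there are admissible $f$ with left-hand side arbitrarily large and $\|Tf\|_p^p$ arbitrarily small. (b) Suppose $k$ is proper at infinity at $x_0$: $\mu(M)=\infty$, $A_\infty>0$ and for some $C$, $\int_{r_1\le d(x_0,y)\le r_2}|k(x_0,y)|^\beta d\mu(y)\ge A_\infty\log\frac{V_{x_0}(r_2)}{V_{x_0}(r_1)}-C$ whenever $1\le V_{x_0}(r_1)<V_{x_0}(r_2)$. If $A_0\le A_\infty$, then in (1) the exponential constant $1/A_\infty$ and the power $p\beta/\beta'$ of the denominator are sharp. Here *sharp* means: if the exponential constant is replaced by any larger one, or the power of the denominator by any smaller one, then the ratio of the left-hand side to $\|Tf\|_p^p$ (with $0<\|Tf\|_p<\infty$), respectively the left-hand side of (3), is unbounded over the admissible $f$. -/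

import Mathlib

open MeasureTheory Set Metric
open scoped ENNReal Nat

noncomputable section

namespace RieszLike

variable {M : Type*} [MetricSpace M] [MeasurableSpace M]

/-- `V_x(r) = μ(B(x,r))`, where `B(x,r) = {y : d(x,y) ≤ r}`, as a real number. -/
def vol (μ : Measure M) (x : M) (r : ℝ) : ℝ := μ.real (closedBall x r)

/-- All balls have finite measure and `r ↦ V_x(r)` is continuous. Balls of negative radius are
empty, so continuity at `r = 0` says that points have measure zero. -/
structure HasContinuousVolume (μ : Measure M) : Prop where
  finite : ∀ x r, μ (closedBall x r) < ∞
  continuous : ∀ x, Continuous fun r : ℝ => vol μ x r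

/-- `∫_{r₁ ≤ d(x,y) ≤ r₂} |k(x,y)|^β dμ(y)`. -/
def annulusIntegral (μ : Measure M) (k : M → M → ℝ) (β : ℝ) (x : M) (r₁ r₂ : ℝ) : ℝ≥0∞ :=
  ∫⁻ y in {y | r₁ ≤ dist x y ∧ dist x y ≤ r₂}, ENNReal.ofReal (|k x y| ^ β) ∂μ

/-- Upper bound on the size of the kernel near the diagonal. -/
def SizeNear (μ : Measure M) (k : M → M → ℝ) (β A₀ B : ℝ) : Prop :=
  ∀ x r₁ r₂, 0 < vol μ x r₁ → vol μ x r₁ < vol μ x r₂ → vol μ x r₂ ≤ 1 →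
    annulusIntegral μ k β x r₁ r₂ ≤
      ENNReal.ofReal (A₀ * Real.log (vol μ x r₂ / vol μ x r₁) + B)

/-- Upper bound on the size of the kernel at infinity. -/
def SizeFar (μ : Measure M) (k : M → M → ℝ) (β Ainf B : ℝ) : Prop :=
  ∀ x r₁ r₂, 1 ≤ vol μ x r₁ → vol μ x r₁ < vol μ x r₂ →
    annulusIntegral μ k β x r₁ r₂ ≤
      ENNReal.ofReal (Ainf * Real.log (vol μ x r₂ / vol μ x r₁) + B)

/-- The pointwise bounds `|k(x,y)| ≤ B V_x(d(x,y))^{-1/β}` and `|k(x,y)| ≤ B V_y(d(x,y))^{-1/β}`,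
where the right-hand sides are read as `+∞` if the volume vanishes. -/
def PointwiseBound (μ : Measure M) (k : M → M → ℝ) (β B : ℝ) : Prop :=
  ∀ x y,
    (0 < vol μ x (dist x y) → |k x y| ≤ B * vol μ x (dist x y) ^ (-(1 / β))) ∧
    (0 < vol μ y (dist x y) → |k x y| ≤ B * vol μ y (dist x y) ^ (-(1 / β)))

/-- The first of the two pointwise bounds, only for `V_x(d(x,y)) ≤ 1`. -/
def PointwiseBoundNear (μ : Measure M) (k : M → M → ℝ) (β B : ℝ) : Prop :=
  ∀ x y, 0 < vol μ x (dist x y) → vol μ x (dist x y) ≤ 1 →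
    |k x y| ≤ B * vol μ x (dist x y) ^ (-(1 / β))

/-- Integral regularity of the kernel in the first variable, for given `x`, `r`. -/
def IntegralRegularAt (μ : Measure M) (k : M → M → ℝ) (β δ Bδ : ℝ) (x : M) (r : ℝ) : Prop :=
  ∀ R > 0, (1 + δ) * vol μ x r ≤ vol μ x R → ∀ x' ∈ closedBall x r,
    ∫⁻ y in {y | R < dist x y}, ENNReal.ofReal (|k x' y - k x y| ^ β) ∂μ ≤ ENNReal.ofReal Bδ

/-- Riesz-like kernels of order `β` with normalization constants `A₀`, `A_∞`. -/
structure IsRieszLike (μ : Measure M) (k : M → M → ℝ) (β A₀ Ainf : ℝ) : Prop where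
  measurable : Measurable (Function.uncurry k)
  one_lt : 1 < β
  A₀_pos : 0 < A₀
  Ainf_nonneg : 0 ≤ Ainf
  size : ∃ B ≥ 0, SizeNear μ k β A₀ B ∧ SizeFar μ k β Ainf B ∧ PointwiseBound μ k β B
  regular : ∀ δ > 0, ∃ Bδ > 0, ∀ x, ∀ r > 0, IntegralRegularAt μ k β δ Bδ x r

/-- Decreasing rearrangement `f^*(t) = inf {s ≥ 0 : μ{|f| > s} ≤ t}`, with values in `[0,∞]`. -/
def rearrangement (μ : Measure M) (f : M → ℝ) (t : ℝ) : ℝ≥0∞ :=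
  sInf {s : ℝ≥0∞ | μ {x | s < ‖f x‖ₑ} ≤ ENNReal.ofReal t}

/-- The weaker conditions on the kernel allowed in the critically integrable case `A_∞ = 0`:
the two size conditions with `A_∞ = 0`, the first pointwise bound for `V_x(d(x,y)) ≤ 1`,
integral regularity for `V_x(r) ≤ 1`, and `k_1^*(t), k_2^*(t) ≤ C t^{-1/β}` for all `t > 0`. -/
structure IsCriticalRieszLike (μ : Measure M) (k : M → M → ℝ) (β A₀ : ℝ) : Prop where
  measurable : Measurable (Function.uncurry k)
  one_lt : 1 < β
  A₀_pos : 0 < A₀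
  size : ∃ B ≥ 0, SizeNear μ k β A₀ B ∧ SizeFar μ k β 0 B ∧ PointwiseBoundNear μ k β B
  regular : ∀ δ > 0, ∃ Bδ > 0, ∀ x, ∀ r > 0, vol μ x r ≤ 1 → IntegralRegularAt μ k β δ Bδ x r
  rearr : ∃ C : ℝ, ∀ t > 0,
    (⨆ x, rearrangement μ (fun y => k x y) t) ≤ ENNReal.ofReal (C * t ^ (-(1 / β))) ∧
    (⨆ y, rearrangement μ (fun x => k x y) t) ≤ ENNReal.ofReal (C * t ^ (-(1 / β)))

/-- The kernel is proper on the diagonal, with base point `x₀`. -/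
def IsProperOnDiagonalAt (μ : Measure M) (k : M → M → ℝ) (β A₀ : ℝ) (x₀ : M) : Prop :=
  ∃ C : ℝ, ∀ r₁ r₂, 0 < vol μ x₀ r₁ → vol μ x₀ r₁ < vol μ x₀ r₂ → vol μ x₀ r₂ ≤ 1 →
    ENNReal.ofReal (A₀ * Real.log (vol μ x₀ r₂ / vol μ x₀ r₁) - C) ≤
      annulusIntegral μ k β x₀ r₁ r₂

/-- The kernel is proper at infinity, with base point `x₀`. -/
def IsProperAtInfinityAt (μ : Measure M) (k : M → M → ℝ) (β Ainf : ℝ) (x₀ : M) : Prop :=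
  μ univ = ∞ ∧ 0 < Ainf ∧
  ∃ C : ℝ, ∀ r₁ r₂, 1 ≤ vol μ x₀ r₁ → vol μ x₀ r₁ < vol μ x₀ r₂ →
    ENNReal.ofReal (Ainf * Real.log (vol μ x₀ r₂ / vol μ x₀ r₁) - C) ≤
      annulusIntegral μ k β x₀ r₁ r₂

/-- Pointwise regularity of order `η` in the first variable at `x₀`; the negative power of the
volume is read as `+∞` where the volume vanishes. -/
def IsXRegularAt (μ : Measure M) (k : M → M → ℝ) (β : ℝ) (x₀ : M) (η : ℝ) : Prop :=
  ∀ δ > 0, ∃ C : ℝ, ∀ r > 0, ∀ R > 0, (1 + δ) * vol μ x₀ r ≤ vol μ x₀ R →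
    ∀ x' ∈ closedBall x₀ r, ∀ y ∉ closedBall x₀ R, 0 < vol μ x₀ (dist x₀ y) →
      |k x' y - k x₀ y| ≤
        C * vol μ x₀ (dist x₀ x') ^ η * vol μ x₀ (dist x₀ y) ^ (-η - 1 / β)

/-- Taylor formula with volume remainder of order `η` in the second variable at `x₀`.
Linear independence on a ball is meant in `L²` of the ball (i.e. up to null sets), so that
orthonormal bases of the span with `m` elements exist on each ball of positive measure. -/
def HasTaylorFormulaAt (μ : Measure M) (k : M → M → ℝ) (β : ℝ) (x₀ : M) (η : ℝ) : Prop :=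
  ∃ m : ℕ, 1 ≤ m ∧ ∃ κ p : Fin m → M → ℝ,
    (∀ j, Measurable (κ j)) ∧ (∀ j, Measurable (p j)) ∧
    -- the `p j` are bounded on balls around `x₀`
    (∀ r > 0, ∀ j, ∃ K : ℝ, ∀ y ∈ closedBall x₀ r, |p j y| ≤ K) ∧
    -- the `p j` are linearly independent on balls around `x₀`
    (∀ r > 0, 0 < vol μ x₀ r → ∀ c : Fin m → ℝ,
      (∀ᵐ y ∂μ.restrict (closedBall x₀ r), ∑ j, c j * p j y = 0) → c = 0) ∧
    -- the remainder estimate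
    (∀ δ > 0, ∃ C : ℝ, ∀ r > 0, ∀ R > 0, (1 + δ) * vol μ x₀ r ≤ vol μ x₀ R →
      ∀ x y, dist y x₀ ≤ r → R ≤ dist x x₀ → 0 < vol μ x₀ (dist x x₀) →
        |k x y - ∑ j, κ j x * p j y| ≤
          C * vol μ x₀ (dist y x₀) ^ η * vol μ x₀ (dist x x₀) ^ (-η - 1 / β)) ∧
    -- uniform bounds for orthonormal bases of the span of the `p j` in `L²(B(x₀,r))`
    (∃ C : ℝ, ∀ r > 0, 0 < vol μ x₀ r → ∀ v : Fin m → M → ℝ,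
      (∀ j, v j ∈ Submodule.span ℝ (range p)) →
      (∀ i j, ∫ y in closedBall x₀ r, v i y * v j y ∂μ = if i = j then 1 else 0) →
      ∀ j, ∀ y ∈ closedBall x₀ r, |v j y| ≤ C / √(vol μ x₀ r))

/-- The potential `Tf(x) = ∫ k(x,y) f(y) dμ(y)`. -/
def potential (μ : Measure M) (k : M → M → ℝ) (f : M → ℝ) (x : M) : ℝ :=
  ∫ y, k x y * f y ∂μ

/-- `‖g‖_q^q`, as an element of `[0,∞]`. -/
def normPow (μ : Measure M) (q : ℝ) (g : M → ℝ) : ℝ≥0∞ :=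
  eLpNorm g (ENNReal.ofReal q) μ ^ q

/-- The functions admitted in the inequalities: measurable, supported in a ball, and with
`‖f‖_{β'}^{β'} + κ ‖Tf‖_{β'}^{β'} ≤ 1`. For `κ = 0` this is `‖f‖_{β'} ≤ 1`. -/
def Admissible (μ : Measure M) (k : M → M → ℝ) (β' κ : ℝ) (f : M → ℝ) : Prop :=
  Measurable f ∧ (∃ c R, Function.support f ⊆ closedBall c R) ∧
    normPow μ β' f + ENNReal.ofReal κ * normPow μ β' (potential μ k f) ≤ 1

/-- The regularized exponential `exp_N(t) = e^t - ∑_{i=0}^N t^i / i!`. -/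
def expReg (N : ℕ) (t : ℝ) : ℝ := Real.exp t - ∑ i ∈ Finset.range (N + 1), t ^ i / (i ! : ℝ)

/-- `∫ exp_{⌈p/β-1⌉}(γ |Tf|^β) / (1 + |Tf|^q) dμ`. -/
def growthIntegral (μ : Measure M) (k : M → M → ℝ) (β p γ q : ℝ) (f : M → ℝ) : ℝ≥0∞ :=
  ∫⁻ x, ENNReal.ofReal
    (expReg ⌈p / β - 1⌉₊ (γ * |potential μ k f x| ^ β) / (1 + |potential μ k f x| ^ q)) ∂μ

/-- `∫ exp_{⌈β'-2⌉}(γ |Tf|^β) dμ`. -/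
def rufIntegral (μ : Measure M) (k : M → M → ℝ) (β β' γ : ℝ) (f : M → ℝ) : ℝ≥0∞ :=
  ∫⁻ x, ENNReal.ofReal (expReg ⌈β' - 2⌉₊ (γ * |potential μ k f x| ^ β)) ∂μ

/-- Sharpness of the exponential constant `γ₀` in
`∫ exp_{⌈p/β-1⌉}(γ₀ |Tf|^β) / (1 + |Tf|^{pβ/β'}) dμ ≤ C ‖Tf‖_p^p`: for each larger constant the
ratio of the two sides is unbounded. -/
def ExpConstantSharp (μ : Measure M) (k : M → M → ℝ) (β β' p κ γ₀ : ℝ) : Prop :=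
  ∀ γ > γ₀, ∀ C : ℝ, ∃ f, Admissible μ k β' κ f ∧
    0 < normPow μ p (potential μ k f) ∧ normPow μ p (potential μ k f) < ∞ ∧
    ENNReal.ofReal C * normPow μ p (potential μ k f) <
      growthIntegral μ k β p γ (p * β / β') f

/-- The stronger form of sharpness of the exponential constant: for each larger constant the
left-hand side can be arbitrarily large while `‖Tf‖_p^p` is arbitrarily small. -/
def ExpConstantStronglySharp (μ : Measure M) (k : M → M → ℝ) (β β' p κ γ₀ : ℝ) : Prop :=
  ∀ γ > γ₀, ∀ C : ℝ, ∀ ε > (0 : ℝ), ∃ f, Admissible μ k β' κ f ∧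
    0 < normPow μ p (potential μ k f) ∧ normPow μ p (potential μ k f) < ENNReal.ofReal ε ∧
    ENNReal.ofReal C < growthIntegral μ k β p γ (p * β / β') f

/-- Sharpness of the power `pβ/β'` of the denominator, at the exponential constant `γ₀`: for each
smaller power the ratio of the two sides is unbounded. -/
def DenominatorPowerSharp (μ : Measure M) (k : M → M → ℝ) (β β' p κ γ₀ : ℝ) : Prop :=
  ∀ q < p * β / β', ∀ C : ℝ, ∃ f, Admissible μ k β' κ f ∧
    0 < normPow μ p (potential μ k f) ∧ normPow μ p (potential μ k f) < ∞ ∧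
    ENNReal.ofReal C * normPow μ p (potential μ k f) < growthIntegral μ k β p γ₀ q f

/-- Sharpness of the exponential constant `γ₀` in `∫ exp_{⌈β'-2⌉}(γ₀ |Tf|^β) dμ ≤ C`. -/
def RufConstantSharp (μ : Measure M) (k : M → M → ℝ) (β β' κ γ₀ : ℝ) : Prop :=
  ∀ γ > γ₀, ∀ C : ℝ, ∃ f, Admissible μ k β' κ f ∧
    ENNReal.ofReal C < rufIntegral μ k β β' γ f

end RieszLike

end

/-!
The function `f = sgn k(x₀,·) |k(x₀,·)|^{β-1}` on the annulus `r₁ ≤ d(x₀, ·) ≤ r₂` satisfies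
`‖f‖_{β'}^{β'} = Tf(x₀) = L`, where `L` is the integral of `|k(x₀,·)|^β` over the annulus.
Subtracting from `f` its projection onto the span of the `p_j` in `L²(B(x₀, r₂))` changes both
quantities only by `O(1)`, and by the regularity of `k` in the first variable `Tf = L + O(1)` on a
whole ball of volume `V(r₁) / 4`. Since the corrected function is orthogonal to the `p_j`, the
Taylor formula makes `Tf` decay like `V^{-η-1/β}` away from `x₀`; this is what
`p > (1 + p/β') / (1 + η)` needs to give `‖Tf‖_p^p = O(V(r₂))`.

Now normalize by `N = L + O(1)`. The potential of `N^{-1/β'} f` satisfies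
`|T(N^{-1/β'} f)|^β = N + O(1)` on a set of measure comparable to `V(r₁)`, which is at least of
the order `V(r₂) e^{-N/A}` if the kernel is proper, whereas the `p`-th power of its norm is
`O(N^{-p/β'} V(r₂))`. The integral of `e^{γ|Tf|^β} / (1 + |Tf|^q)` is therefore at least of the
order `V(r₂) e^{(γ - 1/A) N} N^{-q/β}`, and its ratio to the norm is unbounded as `N → ∞` as soon
as `γ > 1/A`, or `γ = 1/A` and `q < pβ/β'`.
-/

noncomputable section

namespace RieszLike

/-! ### Functions in weak `L¹` -/

/-- `h` is in weak `L¹`, with constant `K`. Applied to `h = |k(x,·)|^β` this is the size condition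
on the kernel that both classes of kernels have in common. -/
def WeakL1With {α : Type*} [MeasurableSpace α] (K : ℝ) (h : α → ℝ) (μ : Measure α) : Prop :=
  ∀ s > 0, μ {y | s < h y} ≤ ENNReal.ofReal (K / s)

theorem lintegral_Ioc_rpow {r T : ℝ} (hr : -1 < r) (hT : 0 ≤ T) :
    ∫⁻ t in Ioc 0 T, ENNReal.ofReal (t ^ r) = ENNReal.ofReal (T ^ (r + 1) / (r + 1)) := by
  have hi : IntegrableOn (fun t : ℝ => t ^ r) (Ioc 0 T) :=
    (intervalIntegrable_iff_integrableOn_Ioc_of_le hT).1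
      (intervalIntegral.intervalIntegrable_rpow' hr)
  rw [← ofReal_integral_eq_lintegral_ofReal hi, ← intervalIntegral.integral_of_le hT,
    integral_rpow (Or.inl hr), Real.zero_rpow (by linarith), sub_zero]
  filter_upwards [ae_restrict_mem measurableSet_Ioc] with t ht
  exact Real.rpow_nonneg ht.1.le _

theorem lintegral_Ioi_rpow {r T : ℝ} (hr : r < -1) (hT : 0 < T) :
    ∫⁻ t in Ioi T, ENNReal.ofReal (t ^ r) = ENNReal.ofReal (T ^ (r + 1) / (-(r + 1))) := by
  rw [← ofReal_integral_eq_lintegral_ofReal (integrableOn_Ioi_rpow_of_lt hr hT),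
    integral_Ioi_rpow_of_lt hr hT, neg_div, ← div_neg]
  filter_upwards [ae_restrict_mem measurableSet_Ioi] with t ht
  exact Real.rpow_nonneg (hT.trans ht).le _

namespace WeakL1With

variable {α : Type*} [MeasurableSpace α] {μ : Measure α} {h : α → ℝ} {K : ℝ}

theorem restrict (hw : WeakL1With K h μ) (F : Set α) : WeakL1With K h (μ.restrict F) :=
  fun s hs => (Measure.restrict_apply_le _ _).trans (hw s hs)

theorem meas_lt_mul_rpow_le (hw : WeakL1With K h μ) {t : ℝ} (ht : 0 < t) (a : ℝ) :
    μ {y | t < h y} * ENNReal.ofReal (t ^ (a - 1)) ≤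
      ENNReal.ofReal K * ENNReal.ofReal (t ^ (a - 2)) := by
  calc _ ≤ ENNReal.ofReal (K / t) * ENNReal.ofReal (t ^ (a - 1)) := by gcongr; exact hw t ht
    _ = _ := by
      rw [← ENNReal.ofReal_mul' (by positivity), ← ENNReal.ofReal_mul' (by positivity),
        show a - 1 = (a - 2) + 1 by ring, Real.rpow_add_one ht.ne']
      congr 1
      field_simp

theorem lintegral_Ioi_meas_lt_mul_rpow_le (hw : WeakL1With K h μ) (hK : 0 ≤ K) {a T : ℝ}
    (ha : a < 1) (hT : 0 < T) :
    ∫⁻ t in Ioi T, μ {y | t < h y} * ENNReal.ofReal (t ^ (a - 1)) ≤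
      ENNReal.ofReal (K * (T ^ (a - 1) / (1 - a))) := by
  calc _ ≤ ∫⁻ t in Ioi T, ENNReal.ofReal K * ENNReal.ofReal (t ^ (a - 2)) :=
        setLIntegral_mono' measurableSet_Ioi fun t ht =>
          hw.meas_lt_mul_rpow_le (hT.trans ht) a
    _ = _ := by
      rw [lintegral_const_mul' _ _ ENNReal.ofReal_ne_top, lintegral_Ioi_rpow (by linarith) hT,
        ← ENNReal.ofReal_mul hK]
      ring_nf

theorem lintegral_Ioc_meas_lt_mul_rpow_le (hw : WeakL1With K h μ) (hK : 0 ≤ K) {b T : ℝ}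
    (hb : 1 < b) (hT : 0 ≤ T) :
    ∫⁻ t in Ioc 0 T, μ {y | t < h y} * ENNReal.ofReal (t ^ (b - 1)) ≤
      ENNReal.ofReal (K * (T ^ (b - 1) / (b - 1))) := by
  calc _ ≤ ∫⁻ t in Ioc 0 T, ENNReal.ofReal K * ENNReal.ofReal (t ^ (b - 2)) :=
        setLIntegral_mono' measurableSet_Ioc fun t ht => hw.meas_lt_mul_rpow_le ht.1 b
    _ = _ := by
      rw [lintegral_const_mul' _ _ ENNReal.ofReal_ne_top, lintegral_Ioc_rpow (by linarith) hT,
        ← ENNReal.ofReal_mul hK]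
      ring_nf

theorem setLIntegral_rpow_le (hw : WeakL1With K h μ) (hK : 0 ≤ K) (hm : Measurable h)
    (h0 : ∀ y, 0 ≤ h y) {a : ℝ} (ha : 0 ≤ a) (ha1 : a < 1) {F : Set α} {m : ℝ} (hm0 : 0 < m)
    (hF : μ F ≤ ENNReal.ofReal m) :
    ∫⁻ y in F, ENNReal.ofReal (h y ^ a) ∂μ ≤
      ENNReal.ofReal ((1 + K * a / (1 - a)) * m ^ (1 - a)) := by
  rcases ha.eq_or_lt with rfl | ha
  · simpa using hF
  -- Split the layer cake at height `1 / m`, where `μ F` and the weak type bound balance.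
  have hT : 0 < m⁻¹ := inv_pos.2 hm0
  have hlow : ∫⁻ t in Ioc 0 m⁻¹, μ.restrict F {y | t < h y} * ENNReal.ofReal (t ^ (a - 1)) ≤
      ENNReal.ofReal (m * (m⁻¹ ^ a / a)) := by
    calc _ ≤ ∫⁻ t in Ioc 0 m⁻¹, ENNReal.ofReal m * ENNReal.ofReal (t ^ (a - 1)) := by
          gcongr with t
          exact (measure_mono (subset_univ _)).trans (by simpa using hF)
      _ = _ := by
          rw [lintegral_const_mul' _ _ ENNReal.ofReal_ne_top,
            lintegral_Ioc_rpow (by linarith) hT.le, ← ENNReal.ofReal_mul hm0.le, sub_add_cancel]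
  have hhigh := (hw.restrict F).lintegral_Ioi_meas_lt_mul_rpow_le hK ha1 hT
  have ha' : 0 < 1 - a := by linarith
  calc _ = ENNReal.ofReal a *
        ∫⁻ t in Ioi 0, μ.restrict F {y | t < h y} * ENNReal.ofReal (t ^ (a - 1)) :=
        lintegral_rpow_eq_lintegral_meas_lt_mul _ (.of_forall h0) hm.aemeasurable ha
    _ ≤ ENNReal.ofReal a * (ENNReal.ofReal (m * (m⁻¹ ^ a / a)) +
        ENNReal.ofReal (K * (m⁻¹ ^ (a - 1) / (1 - a)))) := by
        rw [← Ioc_union_Ioi_eq_Ioi hT.le]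
        gcongr
        exact (lintegral_union_le _ _ _).trans (add_le_add hlow hhigh)
    _ = _ := by
        rw [← ENNReal.ofReal_add (by positivity) (by positivity), ← ENNReal.ofReal_mul ha.le,
          Real.inv_rpow hm0.le, Real.inv_rpow hm0.le, ← Real.rpow_neg hm0.le (a - 1), neg_sub,
          show m ^ (1 - a) = m * (m ^ a)⁻¹ by
            rw [Real.rpow_sub hm0, Real.rpow_one, div_eq_mul_inv]]
        congr 1
        field_simp

theorem setLIntegral_rpow_le_of_le (hw : WeakL1With K h μ) (hK : 0 ≤ K) (hm : Measurable h)
    (h0 : ∀ y, 0 ≤ h y) {b : ℝ} (hb : 1 < b) {T : ℝ} (hT : 0 < T) :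
    ∫⁻ y in {y | h y ≤ T}, ENNReal.ofReal (h y ^ b) ∂μ ≤
      ENNReal.ofReal (K * b / (b - 1) * T ^ (b - 1)) := by
  have hb0 : 0 < b := by linarith
  set ν := μ.restrict {y | h y ≤ T}
  have hlow := (hw.restrict {y | h y ≤ T}).lintegral_Ioc_meas_lt_mul_rpow_le hK hb hT.le
  have hhigh : ∫⁻ t in Ioi T, ν {y | t < h y} * ENNReal.ofReal (t ^ (b - 1)) = 0 := by
    refine (setLIntegral_congr_fun measurableSet_Ioi fun t ht => ?_).trans lintegral_zero
    have hsub : {y | t < h y} ⊆ {y | h y ≤ T}ᶜ := fun y (hy : t < h y) =>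
      not_le.2 (lt_trans ht hy)
    have hnull : ν {y | t < h y} = 0 :=
      measure_mono_null hsub
        (mem_ae_iff.1 (ae_restrict_mem (measurableSet_le hm measurable_const)))
    rw [hnull, zero_mul]
  calc _ = ENNReal.ofReal b *
        ∫⁻ t in Ioi 0, ν {y | t < h y} * ENNReal.ofReal (t ^ (b - 1)) :=
        lintegral_rpow_eq_lintegral_meas_lt_mul _ (.of_forall h0) hm.aemeasurable hb0
    _ ≤ ENNReal.ofReal b * (ENNReal.ofReal (K * (T ^ (b - 1) / (b - 1))) + 0) := by
        rw [← Ioc_union_Ioi_eq_Ioi hT.le]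
        gcongr
        exact (lintegral_union_le _ _ _).trans (add_le_add hlow hhigh.le)
    _ = _ := by
        rw [add_zero, ← ENNReal.ofReal_mul hb0.le]
        congr 1
        ring

end WeakL1With

/-! ### Volumes of balls -/

section Volume

variable {M : Type*} [MetricSpace M] [MeasurableSpace M] {μ : Measure M}

theorem vol_nonneg (x : M) (r : ℝ) : 0 ≤ vol μ x r := measureReal_nonneg

theorem vol_of_neg (x : M) {r : ℝ} (hr : r < 0) : vol μ x r = 0 := by
  simp [vol, closedBall_eq_empty.2 hr]

/-- `1 / V_x(d(x,y))`, with the value `0` where the volume vanishes. It has weak `L¹` constant `1`,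
and the powers of volumes in the pointwise estimates are integrated as powers of it. -/
def invVol (μ : Measure M) (x y : M) : ℝ := (vol μ x (dist x y))⁻¹

theorem invVol_nonneg (x y : M) : 0 ≤ invVol μ x y := inv_nonneg.2 (vol_nonneg _ _)

namespace HasContinuousVolume

theorem ofReal_vol (hv : HasContinuousVolume μ) (x : M) (r : ℝ) :
    ENNReal.ofReal (vol μ x r) = μ (closedBall x r) :=
  ENNReal.ofReal_toReal (hv.finite x r).ne

theorem vol_mono (hv : HasContinuousVolume μ) (x : M) : Monotone (vol μ x) := fun _ r h =>
  measureReal_mono (closedBall_subset_closedBall h) (hv.finite x r).ne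

theorem vol_zero (hv : HasContinuousVolume μ) (x : M) : vol μ x 0 = 0 := by
  have hleft : Filter.Tendsto (vol μ x) (nhdsWithin 0 (Iio 0)) (nhds (vol μ x 0)) :=
    ((hv.continuous x).tendsto 0).mono_left nhdsWithin_le_nhds
  refine tendsto_nhds_unique hleft (tendsto_const_nhds.congr' ?_)
  filter_upwards [self_mem_nhdsWithin] with r hr
  exact (vol_of_neg x hr).symm

theorem lt_of_vol_lt (hv : HasContinuousVolume μ) {x : M} {r s : ℝ} (h : vol μ x r < vol μ x s) :
    r < s :=
  (hv.vol_mono x).reflect_lt h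

theorem pos_of_vol_pos (hv : HasContinuousVolume μ) {x : M} {r : ℝ} (h : 0 < vol μ x r) : 0 < r :=
  hv.lt_of_vol_lt ((hv.vol_zero x).trans_lt h)

theorem exists_vol_eq (hv : HasContinuousVolume μ) {x : M} {t r : ℝ} (ht : 0 ≤ t)
    (htr : t ≤ vol μ x r) : ∃ s, vol μ x s = t :=
  mem_range_of_exists_le_of_exists_ge (hv.continuous x) ⟨0, by rwa [hv.vol_zero]⟩ ⟨r, htr⟩

theorem exists_lt_vol (hv : HasContinuousVolume μ) (x : M) {c : ℝ}
    (hc : ENNReal.ofReal c < μ univ) : ∃ r, c < vol μ x r := by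
  by_contra! h
  refine hc.not_ge ?_
  have hmono : Monotone fun n : ℕ => closedBall x (n : ℝ) := fun m n hmn =>
    closedBall_subset_closedBall (by exact_mod_cast hmn)
  rw [← iUnion_closedBall_nat x, hmono.measure_iUnion]
  refine iSup_le fun n => ?_
  rw [← hv.ofReal_vol]
  exact ENNReal.ofReal_le_ofReal (h n)

theorem sigmaFinite (hv : HasContinuousVolume μ) [Nonempty M] : SigmaFinite μ := by
  obtain ⟨x⟩ := ‹Nonempty M›
  exact ⟨⟨⟨fun n : ℕ => closedBall x n, fun _ => trivial, fun n => hv.finite x n,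
    iUnion_closedBall_nat x⟩⟩⟩

theorem measure_vol_dist_le (hv : HasContinuousVolume μ) (x : M) {t : ℝ} (ht : 0 ≤ t) :
    μ {y | vol μ x (dist x y) ≤ t} ≤ ENNReal.ofReal t := by
  by_cases hc : ENNReal.ofReal t < μ univ
  · obtain ⟨r, hr⟩ := hv.exists_lt_vol x hc
    -- The sublevel set is the ball whose radius is the largest `s` with `V_x(s) ≤ t`.
    set S := {s : ℝ | vol μ x s ≤ t}
    have hbdd : BddAbove S := ⟨r, fun s hs => (hv.lt_of_vol_lt (lt_of_le_of_lt hs hr)).le⟩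
    have hmem : sSup S ∈ S :=
      (isClosed_le (hv.continuous x) continuous_const).csSup_mem ⟨0, (hv.vol_zero x).trans_le ht⟩
        hbdd
    calc _ ≤ μ (closedBall x (sSup S)) :=
          measure_mono fun y hy => mem_closedBall'.2 (le_csSup hbdd hy)
      _ ≤ _ := by
          rw [← hv.ofReal_vol]
          exact ENNReal.ofReal_le_ofReal hmem
  · exact (measure_mono (subset_univ _)).trans (not_lt.1 hc)

theorem ae_vol_dist_pos (hv : HasContinuousVolume μ) (x : M) : ∀ᵐ y ∂μ, 0 < vol μ x (dist x y) := by
  simpa [ae_iff] using hv.measure_vol_dist_le x le_rfl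

theorem measurable_vol_dist (hv : HasContinuousVolume μ) [OpensMeasurableSpace M] (x : M) :
    Measurable fun y => vol μ x (dist x y) :=
  ((hv.continuous x).comp (continuous_const.dist continuous_id)).measurable

theorem measurable_invVol (hv : HasContinuousVolume μ) [OpensMeasurableSpace M] (x : M) :
    Measurable (invVol μ x) :=
  (hv.measurable_vol_dist x).inv

theorem weakL1With_invVol (hv : HasContinuousVolume μ) (x : M) : WeakL1With 1 (invVol μ x) μ := by
  intro s hs
  refine (measure_mono fun y (hy : s < invVol μ x y) => ?_).trans
    (hv.measure_vol_dist_le x (by positivity))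
  have hpos : 0 < vol μ x (dist x y) := inv_pos.1 (hs.trans hy)
  simpa using ((lt_inv_comm₀ hs hpos).1 hy).le

end HasContinuousVolume

end Volume

/-! ### Kernels of weak type -/

/-- The kernel is measurable, and `|k(x,·)|^β` and `|k(·,y)|^β` are in weak `L¹` with the same
constant `K` for all `x` and `y`. Both classes of kernels are of this type. -/
structure HasWeakType {α : Type*} [MeasurableSpace α] (μ : Measure α) (k : α → α → ℝ)
    (β K : ℝ) : Prop where
  measurable : Measurable (Function.uncurry k)
  nonneg : 0 ≤ K
  left : ∀ x, WeakL1With K (fun y => |k x y| ^ β) μ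
  right : ∀ y, WeakL1With K (fun x => |k x y| ^ β) μ

theorem weakL1With_of_rearrangement_le {α : Type*} [MeasurableSpace α] {μ : Measure α} {β C : ℝ}
    (hβ : 0 < β) (g : α → ℝ)
    (hg : ∀ t > 0, rearrangement μ g t ≤ ENNReal.ofReal (C * t ^ (-(1 / β)))) :
    WeakL1With ((|C| + 1) ^ β) (fun y => |g y| ^ β) μ := by
  intro s hs
  have hC : 0 < |C| + 1 := by positivity
  have ht : 0 < (|C| + 1) ^ β / s := by positivity
  have hlt : C * ((|C| + 1) ^ β / s) ^ (-(1 / β)) < s ^ (1 / β) := by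
    rw [Real.rpow_neg ht.le, Real.div_rpow (by positivity) hs.le, ← Real.rpow_mul hC.le,
      mul_one_div_cancel hβ.ne', Real.rpow_one, inv_div, ← mul_div_assoc, div_lt_iff₀ hC, mul_comm]
    exact mul_lt_mul_of_pos_left (by linarith [le_abs_self C]) (by positivity)
  obtain ⟨a, ha, has⟩ := sInf_lt_iff.1
    ((hg _ ht).trans_lt ((ENNReal.ofReal_lt_ofReal_iff (by positivity)).2 hlt))
  refine (measure_mono fun y (hy : s < |g y| ^ β) => has.trans_le ?_).trans ha
  rw [← ofReal_norm, Real.norm_eq_abs]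
  refine ENNReal.ofReal_le_ofReal ?_
  calc s ^ (1 / β) ≤ (|g y| ^ β) ^ (1 / β) := by gcongr
    _ = |g y| := by
      rw [← Real.rpow_mul (abs_nonneg _), mul_one_div_cancel hβ.ne', Real.rpow_one]

section

variable {M : Type*} [MetricSpace M] [MeasurableSpace M] {μ : Measure M}

theorem HasContinuousVolume.weakL1With_of_abs_le (hv : HasContinuousVolume μ) {β B : ℝ}
    (hβ : 0 < β) (hB : 0 ≤ B) (x : M) (g : M → ℝ)
    (hg : ∀ y, 0 < vol μ x (dist x y) → |g y| ≤ B * vol μ x (dist x y) ^ (-(1 / β))) :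
    WeakL1With (B ^ β) (fun y => |g y| ^ β) μ := by
  intro s hs
  refine le_trans (measure_mono_ae ?_) (hv.measure_vol_dist_le x (by positivity))
  filter_upwards [hv.ae_vol_dist_pos x] with y hy (hys : s < |g y| ^ β)
  have hle : |g y| ^ β ≤ B ^ β / vol μ x (dist x y) := by
    calc _ ≤ (B * vol μ x (dist x y) ^ (-(1 / β))) ^ β := by gcongr; exact hg y hy
      _ = _ := by
        rw [Real.mul_rpow hB (by positivity), ← Real.rpow_mul hy.le, neg_mul,
          one_div_mul_cancel hβ.ne', Real.rpow_neg_one, div_eq_mul_inv]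
  exact (le_div_comm₀ hs hy).1 (hys.le.trans hle)

theorem IsRieszLike.exists_hasWeakType (hv : HasContinuousVolume μ) {k : M → M → ℝ}
    {β A₀ Ainf : ℝ} (hk : IsRieszLike μ k β A₀ Ainf) : ∃ K, HasWeakType μ k β K := by
  obtain ⟨B, hB, -, -, hb⟩ := hk.size
  have hβ : 0 < β := zero_lt_one.trans hk.one_lt
  refine ⟨B ^ β, hk.measurable, by positivity,
    fun x => hv.weakL1With_of_abs_le hβ hB x _ fun y => (hb x y).1,
    fun y => hv.weakL1With_of_abs_le hβ hB y _ fun x => ?_⟩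
  rw [dist_comm]
  exact (hb x y).2

theorem IsCriticalRieszLike.exists_hasWeakType {k : M → M → ℝ} {β A₀ : ℝ}
    (hk : IsCriticalRieszLike μ k β A₀) : ∃ K, HasWeakType μ k β K := by
  obtain ⟨C, hC⟩ := hk.rearr
  have hβ : 0 < β := zero_lt_one.trans hk.one_lt
  exact ⟨(|C| + 1) ^ β, hk.measurable, by positivity,
    fun x => weakL1With_of_rearrangement_le hβ _ fun t ht => iSup_le_iff.1 (hC t ht).1 x,
    fun y => weakL1With_of_rearrangement_le hβ _ fun t ht => iSup_le_iff.1 (hC t ht).2 y⟩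

end

/-! ### The mixed weak type estimate -/

theorem ENNReal_rpow_mul_rpow_le_add (x y : ℝ≥0∞) {u w : ℝ} (hu : 0 ≤ u) (hw : 0 ≤ w) :
    x ^ u * y ^ w ≤ x ^ (u + w) + y ^ (u + w) := by
  rcases le_total x y with h | h
  · calc x ^ u * y ^ w ≤ y ^ u * y ^ w := by gcongr
      _ = y ^ (u + w) := (ENNReal.rpow_add_of_nonneg _ _ hu hw).symm
      _ ≤ _ := le_add_self
  · calc x ^ u * y ^ w ≤ x ^ u * x ^ w := by gcongr
      _ = x ^ (u + w) := (ENNReal.rpow_add_of_nonneg _ _ hu hw).symm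
      _ ≤ _ := le_self_add

theorem ENNReal_rpow_le_one_add_rpow (x : ℝ≥0∞) {q Q : ℝ} (hq : 0 ≤ q) (hQ : q ≤ Q) :
    x ^ q ≤ 1 + x ^ Q := by
  rcases le_total x 1 with h | h
  · exact (ENNReal.rpow_le_one h hq).trans le_self_add
  · exact (ENNReal.rpow_le_rpow_of_exponent_le h hQ).trans le_add_self

section

variable {α : Type*} [MeasurableSpace α] {μ : Measure α}

theorem rpow_lintegral_rpow_mul_rpow_le {f g : α → ℝ≥0∞} (hf : AEMeasurable f μ)
    (hg : AEMeasurable g μ) {a b θ Q : ℝ} (hab : a + b = 1) (hQ : 1 < Q) (hθ : 0 ≤ θ)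
    (ha : θ / Q ≤ a) (hb : θ / Q ≤ b) :
    (∫⁻ y, f y ^ a * g y ^ b ∂μ) ^ Q ≤
      (∫⁻ y, f y ^ ((Q - 2 * θ) / (Q - 1)) ∂μ + ∫⁻ y, g y ^ ((Q - 2 * θ) / (Q - 1)) ∂μ) ^ (Q - 1) *
        ∫⁻ y, f y ^ θ * g y ^ θ ∂μ := by
  have hQ0 : 0 < Q := by linarith
  have hQ1 : 0 < Q - 1 := by linarith
  have hconj : Q.HolderConjugate (Q / (Q - 1)) := .conjExponent hQ
  set Q' := Q / (Q - 1) with hQ'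
  have hQ'0 : 0 < Q' := hconj.symm.pos
  have hsplit (y : α) :
      f y ^ a * g y ^ b = (f y ^ (a - θ / Q) * g y ^ (b - θ / Q)) * (f y * g y) ^ (θ / Q) := by
    rw [ENNReal.mul_rpow_of_nonneg _ _ (by positivity : 0 ≤ θ / Q), mul_mul_mul_comm,
      ← ENNReal.rpow_add_of_nonneg _ _ (sub_nonneg.2 ha) (by positivity),
      ← ENNReal.rpow_add_of_nonneg _ _ (sub_nonneg.2 hb) (by positivity), sub_add_cancel,
      sub_add_cancel]
  have hsum : (a - θ / Q) * Q' + (b - θ / Q) * Q' = (Q - 2 * θ) / (Q - 1) := by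
    rw [← add_mul, show a - θ / Q + (b - θ / Q) = a + b - 2 * (θ / Q) by ring, hab, hQ']
    field_simp
  have hholder := ENNReal.lintegral_mul_le_Lp_mul_Lq μ hconj.symm
    ((hf.pow_const (a - θ / Q)).mul (hg.pow_const (b - θ / Q))) ((hf.mul hg).pow_const (θ / Q))
  calc _ ≤ ((∫⁻ y, (f y ^ (a - θ / Q) * g y ^ (b - θ / Q)) ^ Q' ∂μ) ^ (1 / Q') *
        (∫⁻ y, ((f y * g y) ^ (θ / Q)) ^ Q ∂μ) ^ (1 / Q)) ^ Q := by
        simp_rw [hsplit]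
        gcongr
        exact hholder
    _ = (∫⁻ y, (f y ^ (a - θ / Q) * g y ^ (b - θ / Q)) ^ Q' ∂μ) ^ (Q - 1) *
        ∫⁻ y, f y ^ θ * g y ^ θ ∂μ := by
        rw [ENNReal.mul_rpow_of_nonneg _ _ hQ0.le, ← ENNReal.rpow_mul, ← ENNReal.rpow_mul,
          one_div_mul_cancel hQ0.ne', ENNReal.rpow_one, show 1 / Q' * Q = Q - 1 by
            rw [hQ']; field_simp]
        simp_rw [← ENNReal.rpow_mul, div_mul_cancel₀ _ hQ0.ne', ENNReal.mul_rpow_of_nonneg _ _ hθ]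
    _ ≤ _ := by
        rw [← lintegral_add_left' (hf.pow_const _)]
        gcongr with y
        rw [ENNReal.mul_rpow_of_nonneg _ _ hQ'0.le, ← ENNReal.rpow_mul, ← ENNReal.rpow_mul, ← hsum]
        exact ENNReal_rpow_mul_rpow_le_add _ _ (mul_nonneg (sub_nonneg.2 ha) hQ'0.le)
          (mul_nonneg (sub_nonneg.2 hb) hQ'0.le)

variable {k : α → α → ℝ} {h : α → ℝ} {β β' K L : ℝ}

theorem HasWeakType.lintegral_lintegral_rpow_mul_le [SFinite μ] (hk : HasWeakType μ k β K)
    (hw : WeakL1With L h μ) (hL : 0 ≤ L) (hm : Measurable h) (h0 : ∀ y, 0 ≤ h y) {θ : ℝ}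
    (hθ : 0 ≤ θ) (hθ1 : θ < 1) {ρ σ : ℝ} (hρ : 0 < ρ) (hσ : 0 < σ) {E F : Set α}
    (hE : μ E ≤ ENNReal.ofReal σ) (hF : μ F ≤ ENNReal.ofReal ρ) :
    ∫⁻ x in E, ∫⁻ y in F, ENNReal.ofReal (|k x y| ^ β) ^ θ * ENNReal.ofReal (h y) ^ θ ∂μ ∂μ ≤
      ENNReal.ofReal ((1 + K * θ / (1 - θ)) * σ ^ (1 - θ)) *
        ENNReal.ofReal ((1 + L * θ / (1 - θ)) * ρ ^ (1 - θ)) := by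
  have hkm : Measurable fun z : α × α => |k z.1 z.2| ^ β := hk.measurable.abs.pow_const β
  have hmeas : Measurable (Function.uncurry fun x y =>
      ENNReal.ofReal (|k x y| ^ β) ^ θ * ENNReal.ofReal (h y) ^ θ) :=
    (hkm.ennreal_ofReal.pow_const θ).mul ((hm.comp measurable_snd).ennreal_ofReal.pow_const θ)
  rw [lintegral_lintegral_swap hmeas.aemeasurable]
  calc _ ≤ ∫⁻ y in F, ENNReal.ofReal ((1 + K * θ / (1 - θ)) * σ ^ (1 - θ)) *
        ENNReal.ofReal (h y) ^ θ ∂μ := by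
        gcongr with y
        rw [lintegral_mul_const' _ _ (by finiteness)]
        gcongr
        simp_rw [ENNReal.ofReal_rpow_of_nonneg (Real.rpow_nonneg (abs_nonneg _) _) hθ]
        exact (hk.right y).setLIntegral_rpow_le hk.nonneg
          (hk.measurable.of_uncurry_right.abs.pow_const β) (fun x => by positivity) hθ hθ1 hσ hE
    _ ≤ _ := by
        rw [lintegral_const_mul' _ _ ENNReal.ofReal_ne_top]
        gcongr
        simp_rw [ENNReal.ofReal_rpow_of_nonneg (h0 _) hθ]
        exact hw.setLIntegral_rpow_le hL hm h0 hθ hθ1 hρ hF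

-- Any `θ ∈ (1/2, 1)` would do for `3/4`: powers of weak `L¹` functions with exponents `θ` and
-- `(Q - 2θ) / (Q - 1)`, both less than `1`, are integrable over sets of finite measure.
theorem HasWeakType.rpow_lintegral_mul_rpow_le (hk : HasWeakType μ k β K)
    (hβ : β.HolderConjugate β') (hw : WeakL1With L h μ) (hL : 0 ≤ L) (hm : Measurable h)
    (h0 : ∀ y, 0 ≤ h y) {Q : ℝ} (hQ : β ≤ Q) (hQ' : β' ≤ Q) (hQ2 : 2 ≤ Q) :
    ∃ C ≥ 0, ∀ ρ > 0, ∀ F : Set α, μ F ≤ ENNReal.ofReal ρ → ∀ x,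
      (∫⁻ y in F, ‖k x y‖ₑ * ENNReal.ofReal (h y ^ (1 / β')) ∂μ) ^ Q ≤
        ENNReal.ofReal (C * ρ ^ (1 / 2 : ℝ)) * ∫⁻ y in F,
          ENNReal.ofReal (|k x y| ^ β) ^ (3 / 4 : ℝ) * ENNReal.ofReal (h y) ^ (3 / 4 : ℝ) ∂μ := by
  have hβ0 := hβ.pos
  have hβ0' := hβ.symm.pos
  have hQ1 : 0 < Q - 1 := by linarith
  set s := (Q - 2 * (3 / 4)) / (Q - 1) with hs
  have hs0 : 0 ≤ s := div_nonneg (by linarith) hQ1.le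
  have hs1 : 0 < 1 - s := by rw [hs, sub_pos, div_lt_one hQ1]; linarith
  have hK := hk.nonneg
  set c := (1 + K * s / (1 - s)) + (1 + L * s / (1 - s))
  have hc0 : 0 ≤ c := by positivity
  refine ⟨c ^ (Q - 1), by positivity, fun ρ hρ F hF x => ?_⟩
  have hkm : Measurable fun y => |k x y| ^ β := hk.measurable.of_uncurry_left.abs.pow_const β
  have hk_eq (y : α) : ‖k x y‖ₑ * ENNReal.ofReal (h y ^ (1 / β')) =
      ENNReal.ofReal (|k x y| ^ β) ^ (1 / β) * ENNReal.ofReal (h y) ^ (1 / β') := by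
    rw [ENNReal.ofReal_rpow_of_nonneg (by positivity) (by positivity),
      ENNReal.ofReal_rpow_of_nonneg (h0 y) (by positivity), ← Real.rpow_mul (abs_nonneg _),
      mul_one_div_cancel hβ0.ne', Real.rpow_one, ← Real.norm_eq_abs, ofReal_norm]
  have hks := (hk.left x).setLIntegral_rpow_le hK hkm (fun y => by positivity) hs0
    (by linarith) hρ hF
  have hhs := hw.setLIntegral_rpow_le hL hm h0 hs0 (by linarith) hρ hF
  simp_rw [← ENNReal.ofReal_rpow_of_nonneg (Real.rpow_nonneg (abs_nonneg (k x _)) β) hs0] at hks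
  simp_rw [← ENNReal.ofReal_rpow_of_nonneg (h0 _) hs0] at hhs
  simp_rw [hk_eq]
  have hθ {b : ℝ} (hb : 0 < b) (hbQ : b ≤ Q) : 3 / 4 / Q ≤ 1 / b := by
    rw [div_le_div_iff₀ (by linarith) hb]; linarith
  refine (rpow_lintegral_rpow_mul_rpow_le (θ := 3 / 4) hkm.ennreal_ofReal.aemeasurable
    hm.ennreal_ofReal.aemeasurable (by simpa using hβ.inv_add_inv_eq_one) (by linarith)
    (by norm_num) (hθ hβ0 hQ) (hθ hβ0' hQ')).trans ?_
  gcongr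
  calc _ ≤ ENNReal.ofReal (c * ρ ^ (1 - s)) ^ (Q - 1) := by
        rw [add_mul, ENNReal.ofReal_add (by positivity) (by positivity)]
        gcongr
    _ = _ := by
        rw [ENNReal.ofReal_rpow_of_nonneg (by positivity) hQ1.le,
          Real.mul_rpow hc0 (by positivity), ← Real.rpow_mul hρ.le,
          show (1 - s) * (Q - 1) = 1 / 2 by rw [hs]; field_simp; ring]

theorem HasWeakType.lintegral_rpow_lintegral_mul_rpow_le [SFinite μ]
    (hk : HasWeakType μ k β K) (hβ : β.HolderConjugate β') (hw : WeakL1With L h μ) (hL : 0 ≤ L)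
    (hm : Measurable h) (h0 : ∀ y, 0 ≤ h y) {q : ℝ} (hq : 0 ≤ q) :
    ∃ C ≥ 0, ∀ ρ > 0, ∀ E F : Set α, μ E ≤ ENNReal.ofReal (2 * ρ) → μ F ≤ ENNReal.ofReal ρ →
      ∫⁻ x in E, (∫⁻ y in F, ‖k x y‖ₑ * ENNReal.ofReal (h y ^ (1 / β')) ∂μ) ^ q ∂μ ≤
        ENNReal.ofReal (C * ρ) := by
  have hβ1 := hβ.lt
  have hβ1' := hβ.symm.lt
  have hK := hk.nonneg
  obtain ⟨C, hC, hCle⟩ := hk.rpow_lintegral_mul_rpow_le hβ hw hL hm h0 (Q := q + β + β')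
    (by linarith) (by linarith) (by linarith)
  set C' := (1 + K * (3 / 4) / (1 / 4)) * 2 ^ (1 / 4 : ℝ) * (1 + L * (3 / 4) / (1 / 4))
  have : 0 ≤ C' := by positivity
  refine ⟨2 + C * C', by positivity, fun ρ hρ E F hE hF => ?_⟩
  have hdouble := hk.lintegral_lintegral_rpow_mul_le hw hL hm h0 (θ := 3 / 4) (by norm_num)
    (by norm_num) hρ (by positivity) hE hF
  rw [show (1 - 3 / 4 : ℝ) = 1 / 4 by norm_num, ← ENNReal.ofReal_mul (by positivity),
    Real.mul_rpow (by norm_num) hρ.le] at hdouble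
  have hρ2 : ρ ^ (1 / 2 : ℝ) * (ρ ^ (1 / 4 : ℝ) * ρ ^ (1 / 4 : ℝ)) = ρ := by
    rw [← Real.rpow_add hρ, ← Real.rpow_add hρ]
    norm_num
  calc _ ≤ ∫⁻ x in E, (1 + ENNReal.ofReal (C * ρ ^ (1 / 2 : ℝ)) * ∫⁻ y in F,
          ENNReal.ofReal (|k x y| ^ β) ^ (3 / 4 : ℝ) * ENNReal.ofReal (h y) ^ (3 / 4 : ℝ) ∂μ) ∂μ :=
        lintegral_mono fun x => (ENNReal_rpow_le_one_add_rpow _ hq (by linarith)).trans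
          (add_le_add_right (hCle ρ hρ F hF x) 1)
    _ ≤ ENNReal.ofReal (2 * ρ) + ENNReal.ofReal (C * ρ ^ (1 / 2 : ℝ)) * ENNReal.ofReal _ := by
        rw [lintegral_add_left measurable_const, setLIntegral_one,
          lintegral_const_mul' _ _ ENNReal.ofReal_ne_top]
        exact add_le_add hE (mul_le_mul_right hdouble _)
    _ = _ := by
        rw [← ENNReal.ofReal_mul (by positivity),
          ← ENNReal.ofReal_add (by positivity) (by positivity)]
        congr 1
        linear_combination (C * C') * hρ2

end

/-! ### Orthonormalization and moment corrections -/

section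

variable {α : Type*} [MeasurableSpace α] {ν : Measure α} {m : ℕ} {p : Fin m → α → ℝ}

theorem coeFn_sum_smul {u : Fin m → Lp ℝ 2 ν} (hu : ∀ j, u j =ᵐ[ν] p j) (c : Fin m → ℝ) :
    ⇑(∑ j, c j • u j) =ᵐ[ν] fun y => ∑ j, c j * p j y := by
  have hsmul : ∀ᵐ y ∂ν, ∀ j, (c j • u j : Lp ℝ 2 ν) y = c j * u j y :=
    ae_all_iff.2 fun j => Lp.coeFn_smul (c j) (u j)
  filter_upwards [Lp.coeFn_fun_finsetSum Finset.univ fun j => c j • u j, hsmul, ae_all_iff.2 hu]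
    with y hsum hsmul hu
  rw [hsum]
  exact Finset.sum_congr rfl fun j _ => by rw [hsmul, hu]

theorem linearIndependent_toLp (hp : ∀ j, MemLp (p j) 2 ν)
    (hli : ∀ c : Fin m → ℝ, (∀ᵐ y ∂ν, ∑ j, c j * p j y = 0) → c = 0) :
    LinearIndependent ℝ fun j => (hp j).toLp := by
  refine Fintype.linearIndependent_iff.2 fun c hc => congrFun (hli c ?_)
  filter_upwards [coeFn_sum_smul (fun j => (hp j).coeFn_toLp) c, Lp.coeFn_zero ℝ 2 ν] with y hy h0
  rw [← hy, hc, h0, Pi.zero_apply]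

theorem exists_orthonormal_span (hp : ∀ j, MemLp (p j) 2 ν)
    (hli : ∀ c : Fin m → ℝ, (∀ᵐ y ∂ν, ∑ j, c j * p j y = 0) → c = 0) :
    ∃ v : Fin m → α → ℝ, (∀ j, v j ∈ Submodule.span ℝ (range p)) ∧
      (∀ i j, ∫ y, v i y * v j y ∂ν = if i = j then 1 else 0) ∧
      ∀ j, ∃ d : Fin m → ℝ, p j =ᵐ[ν] fun y => ∑ i, d i * v i y := by
  set u : Fin m → Lp ℝ 2 ν := fun j => (hp j).toLp
  set e := InnerProductSpace.gramSchmidtNormed ℝ u with he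
  have hon : Orthonormal ℝ e :=
    InnerProductSpace.gramSchmidtNormed_orthonormal (linearIndependent_toLp hp hli)
  have hspan : Submodule.span ℝ (range e) = Submodule.span ℝ (range u) := by
    rw [he, InnerProductSpace.span_gramSchmidtNormed_range, InnerProductSpace.span_gramSchmidt]
  have hcomb (j : Fin m) : ∃ c : Fin m → ℝ, ∑ i, c i • u i = e j :=
    (Submodule.mem_span_range_iff_exists_fun ℝ).1 (hspan ▸ Submodule.subset_span ⟨j, rfl⟩)
  choose c hc using hcomb
  have hv (j : Fin m) : e j =ᵐ[ν] fun y => ∑ i, c j i * p i y :=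
    hc j ▸ coeFn_sum_smul (fun i => (hp i).coeFn_toLp) (c j)
  refine ⟨fun j y => ∑ i, c j i * p i y, fun j => ?_, fun i j => ?_, fun j => ?_⟩
  · exact (Submodule.mem_span_range_iff_exists_fun ℝ).2 ⟨c j, by ext y; simp⟩
  · rw [← orthonormal_iff_ite.1 hon i j, L2.inner_def]
    refine integral_congr_ae ?_
    filter_upwards [hv i, hv j] with y hi hj
    simp [hi, hj, mul_comm]
  · obtain ⟨d, hd⟩ := (Submodule.mem_span_range_iff_exists_fun ℝ).1
      (hspan ▸ Submodule.subset_span ⟨j, rfl⟩ : u j ∈ Submodule.span ℝ (range e))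
    refine ⟨d, (hp j).coeFn_toLp.symm.trans ?_⟩
    have hsum := coeFn_sum_smul hv d
    rwa [hd] at hsum

variable {v : Fin m → α → ℝ} {f : α → ℝ}

theorem integral_mul_sub_projection_eq_zero (hvf : ∀ i, Integrable (fun y => v i y * f y) ν)
    (hvv : ∀ i j, Integrable (fun y => v i y * v j y) ν)
    (hv : ∀ i j, ∫ y, v i y * v j y ∂ν = if i = j then 1 else 0) (i : Fin m) :
    ∫ y, v i y * (f y - ∑ l, (∫ z, v l z * f z ∂ν) * v l y) ∂ν = 0 := by
  have hexpand (y : α) : v i y * (f y - ∑ l, (∫ z, v l z * f z ∂ν) * v l y) =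
      v i y * f y - ∑ l, (∫ z, v l z * f z ∂ν) * (v i y * v l y) := by
    rw [mul_sub, Finset.mul_sum]
    simp only [mul_left_comm]
  simp_rw [hexpand]
  rw [integral_sub (hvf i) (integrable_finsetSum _ fun l _ => (hvv i l).const_mul _),
    integral_finsetSum _ fun l _ => (hvv i l).const_mul _]
  simp_rw [integral_const_mul, hv]
  simp

theorem abs_integral_mul_le (hf : Integrable f ν) {g : α → ℝ} (hg : AEStronglyMeasurable g ν)
    {S : ℝ} (hgb : ∀ᵐ y ∂ν, |g y| ≤ S) : |∫ y, g y * f y ∂ν| ≤ S * ∫ y, |f y| ∂ν := by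
  calc |∫ y, g y * f y ∂ν| ≤ ∫ y, |g y * f y| ∂ν := abs_integral_le_integral_abs
    _ ≤ ∫ y, S * |f y| ∂ν := by
        refine integral_mono_ae (hf.bdd_mul hg hgb).abs (hf.abs.const_mul _) ?_
        filter_upwards [hgb] with y hy
        rw [abs_mul]
        gcongr
    _ = S * ∫ y, |f y| ∂ν := integral_const_mul _ _

theorem abs_projection_le (hf : Integrable f ν) (hvm : ∀ i, Measurable (v i)) {S : ℝ}
    (hvb : ∀ᵐ y ∂ν, ∀ i, |v i y| ≤ S) {y : α} (hy : ∀ i, |v i y| ≤ S) :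
    |∑ i, (∫ z, v i z * f z ∂ν) * v i y| ≤ m * S ^ 2 * ∫ z, |f z| ∂ν := by
  have hterm (i : Fin m) : |(∫ z, v i z * f z ∂ν) * v i y| ≤ S ^ 2 * ∫ z, |f z| ∂ν := by
    have : 0 ≤ S := (abs_nonneg _).trans (hy i)
    have hI : |∫ z, v i z * f z ∂ν| ≤ S * ∫ z, |f z| ∂ν :=
      abs_integral_mul_le hf (hvm i).aestronglyMeasurable (hvb.mono fun z hz => hz i)
    calc _ ≤ (S * ∫ z, |f z| ∂ν) * S := by
          rw [abs_mul]
          exact mul_le_mul hI (hy i) (abs_nonneg _) ((abs_nonneg _).trans hI)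
      _ = _ := by ring
  calc _ ≤ ∑ i, |(∫ z, v i z * f z ∂ν) * v i y| := Finset.abs_sum_le_sum_abs _ _
    _ ≤ ∑ _i : Fin m, S ^ 2 * ∫ z, |f z| ∂ν := Finset.sum_le_sum fun i _ => hterm i
    _ = _ := by simp [mul_assoc]

end

section

variable {M : Type*} [MetricSpace M] [MeasurableSpace M] {μ : Measure M} {x₀ : M} {m : ℕ}
  {p : Fin m → M → ℝ} {C : ℝ}

/-- The conditions on the functions `p_j` in the Taylor formula at `x₀`, where `C` is the constant
in the bound for their orthonormal bases on balls. -/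
structure IsTaylorSystem (μ : Measure M) (x₀ : M) (p : Fin m → M → ℝ) (C : ℝ) : Prop where
  measurable : ∀ j, Measurable (p j)
  bounded : ∀ r > 0, ∀ j, ∃ K : ℝ, ∀ y ∈ closedBall x₀ r, |p j y| ≤ K
  linearIndependent : ∀ r > 0, 0 < vol μ x₀ r → ∀ c : Fin m → ℝ,
    (∀ᵐ y ∂μ.restrict (closedBall x₀ r), ∑ j, c j * p j y = 0) → c = 0
  orthonormal_bound : ∀ r > 0, 0 < vol μ x₀ r → ∀ v : Fin m → M → ℝ,
    (∀ j, v j ∈ Submodule.span ℝ (range p)) →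
    (∀ i j, ∫ y in closedBall x₀ r, v i y * v j y ∂μ = if i = j then 1 else 0) →
    ∀ j, ∀ y ∈ closedBall x₀ r, |v j y| ≤ C / √(vol μ x₀ r)

namespace IsTaylorSystem

theorem measurable_of_mem_span (hp : IsTaylorSystem μ x₀ p C) {v : M → ℝ}
    (hv : v ∈ Submodule.span ℝ (range p)) : Measurable v := by
  obtain ⟨c, rfl⟩ := (Submodule.mem_span_range_iff_exists_fun ℝ).1 hv
  rw [Finset.sum_fn]
  exact Finset.measurable_fun_sum _ fun i _ => (hp.measurable i).const_smul (c i)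

variable [OpensMeasurableSpace M]

theorem memLp_two (hp : IsTaylorSystem μ x₀ p C) (hv : HasContinuousVolume μ) {r : ℝ} (hr : 0 < r)
    (j : Fin m) : MemLp (p j) 2 (μ.restrict (closedBall x₀ r)) := by
  have : IsFiniteMeasure (μ.restrict (closedBall x₀ r)) := ⟨by simpa using hv.finite x₀ r⟩
  obtain ⟨K, hK⟩ := hp.bounded r hr j
  exact .of_bound (hp.measurable j).aestronglyMeasurable K
    ((ae_restrict_mem isClosed_closedBall.measurableSet).mono hK)

theorem exists_moment_correction (hp : IsTaylorSystem μ x₀ p C) (hv : HasContinuousVolume μ)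
    {r : ℝ} (hr : 0 < vol μ x₀ r) {f : M → ℝ} (hf : IntegrableOn f (closedBall x₀ r) μ) :
    ∃ b : M → ℝ, Measurable b ∧
      (∀ y ∈ closedBall x₀ r,
        |b y| ≤ m * C ^ 2 * ((∫ z in closedBall x₀ r, |f z| ∂μ) / vol μ x₀ r)) ∧
      ∀ j, ∫ y in closedBall x₀ r, p j y * (f y - b y) ∂μ = 0 := by
  have hr0 := hv.pos_of_vol_pos hr
  set ν := μ.restrict (closedBall x₀ r) with hν
  have : IsFiniteMeasure ν := ⟨by simpa [hν] using hv.finite x₀ r⟩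
  obtain ⟨v, hvs, hvo, hvp⟩ := exists_orthonormal_span (hp.memLp_two hv hr0)
    (hp.linearIndependent r hr0 hr)
  have hvm (j : Fin m) : Measurable (v j) := hp.measurable_of_mem_span (hvs j)
  have hvb := hp.orthonormal_bound r hr0 hr v hvs hvo
  have hvb_ae : ∀ᵐ y ∂ν, ∀ j, |v j y| ≤ C / √(vol μ x₀ r) :=
    (ae_restrict_mem isClosed_closedBall.measurableSet).mono fun y hy j => hvb j y hy
  have hvi (j : Fin m) : Integrable (v j) ν :=
    .of_bound (hvm j).aestronglyMeasurable _ (hvb_ae.mono fun y hy => hy j)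
  have hv_mul {g : M → ℝ} (hg : Integrable g ν) (j : Fin m) :
      Integrable (fun y => v j y * g y) ν :=
    hg.bdd_mul (hvm j).aestronglyMeasurable (hvb_ae.mono fun y hy => hy j)
  have hbi : Integrable (fun y => ∑ i, (∫ z, v i z * f z ∂ν) * v i y) ν :=
    integrable_finsetSum _ fun i _ => (hvi i).const_mul _
  refine ⟨fun y => ∑ i, (∫ z, v i z * f z ∂ν) * v i y,
    Finset.measurable_fun_sum _ fun i _ => (hvm i).const_mul _, fun y hy => ?_, fun j => ?_⟩
  · refine (abs_projection_le hf hvm hvb_ae fun i => hvb i y hy).trans_eq ?_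
    rw [div_pow, Real.sq_sqrt hr.le]
    ring
  · obtain ⟨d, hd⟩ := hvp j
    have hres : Integrable (fun y => f y - ∑ l, (∫ z, v l z * f z ∂ν) * v l y) ν := hf.sub hbi
    calc _ = ∫ y, ∑ i, d i * (v i y * (f y - ∑ l, (∫ z, v l z * f z ∂ν) * v l y)) ∂ν := by
          refine integral_congr_ae (hd.mono fun y hy => ?_)
          simp only [hy, Finset.sum_mul, mul_assoc]
      _ = 0 := by
          rw [integral_finsetSum _ fun i _ => (hv_mul hres i).const_mul _]
          simp_rw [integral_const_mul, integral_mul_sub_projection_eq_zero (hv_mul hf)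
            (fun i j => hv_mul (hvi j) i) hvo, mul_zero, Finset.sum_const_zero]

end IsTaylorSystem

end

/-! ### Potentials of cancelling functions -/

theorem normPow_eq_lintegral {α : Type*} [MeasurableSpace α] (μ : Measure α) {q : ℝ} (hq : 0 < q)
    (g : α → ℝ) : normPow μ q g = ∫⁻ x, ‖g x‖ₑ ^ q ∂μ := by
  rw [normPow, eLpNorm_eq_lintegral_rpow_enorm_toReal (by simpa using hq) ENNReal.ofReal_ne_top,
    ENNReal.toReal_ofReal hq.le, ← ENNReal.rpow_mul, one_div_mul_cancel hq.ne', ENNReal.rpow_one]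

theorem WeakL1With.setLIntegral_rpow_one_div_le {α : Type*} [MeasurableSpace α] {μ : Measure α}
    {h : α → ℝ} {K : ℝ} (hw : WeakL1With K h μ) (hK : 0 ≤ K) (hm : Measurable h)
    (h0 : ∀ y, 0 ≤ h y) {β β' : ℝ} (hβ : β.HolderConjugate β') {F : Set α} {ρ : ℝ} (hρ : 0 < ρ)
    (hF : μ F ≤ ENNReal.ofReal ρ) :
    ∫⁻ y in F, ENNReal.ofReal (h y ^ (1 / β)) ∂μ ≤
      ENNReal.ofReal ((1 + K / (β - 1)) * ρ ^ (1 / β')) := by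
  have hβ1 := hβ.sub_one_ne_zero
  have hβ0 := hβ.ne_zero
  have hexp : 1 - 1 / β = 1 / β' := by
    simp only [one_div]
    linarith [hβ.inv_add_inv_eq_one]
  have hconst : K * (1 / β) / (1 - 1 / β) = K / (β - 1) := by field_simp
  rw [← hconst, ← hexp]
  exact hw.setLIntegral_rpow_le hK hm h0 (one_div_nonneg.2 hβ.nonneg)
    ((div_lt_one hβ.pos).2 hβ.lt) hρ hF

theorem HasWeakType.setLIntegral_enorm_le {α : Type*} [MeasurableSpace α] {μ : Measure α}
    {k : α → α → ℝ} {β β' K : ℝ} (hk : HasWeakType μ k β K) (hβ : β.HolderConjugate β') (x : α)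
    {F : Set α} {ρ : ℝ} (hρ : 0 < ρ) (hF : μ F ≤ ENNReal.ofReal ρ) :
    ∫⁻ y in F, ‖k x y‖ₑ ∂μ ≤ ENNReal.ofReal ((1 + K / (β - 1)) * ρ ^ (1 / β')) := by
  have henorm (y : α) : ‖k x y‖ₑ = ENNReal.ofReal ((|k x y| ^ β) ^ (1 / β)) := by
    rw [← Real.rpow_mul (abs_nonneg _), mul_one_div_cancel hβ.ne_zero, Real.rpow_one,
      ← Real.norm_eq_abs, ofReal_norm]
  simp_rw [henorm]
  exact (hk.left x).setLIntegral_rpow_one_div_le hk.nonneg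
    (hk.measurable.of_uncurry_left.abs.pow_const β) (fun y => by positivity) hβ hρ hF

theorem integrable_mul_of_support_subset {α : Type*} [MeasurableSpace α] {μ : Measure α}
    {f g : α → ℝ} (hf : Integrable f μ) (hg : Measurable g) {F : Set α}
    (hs : Function.support f ⊆ F) {C : ℝ} (hC : ∀ y ∈ F, |g y| ≤ C) :
    Integrable (fun y => g y * f y) μ := by
  refine (hf.norm.const_mul C).mono' (hg.aestronglyMeasurable.mul hf.1) (.of_forall fun y => ?_)
  rw [norm_mul]
  by_cases hy : y ∈ F
  · exact mul_le_mul_of_nonneg_right (hC y hy) (norm_nonneg _)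
  · simp [Function.notMem_support.1 fun h => hy (hs h)]

section

variable {M : Type*} [MetricSpace M] [MeasurableSpace M] {μ : Measure M} {x₀ : M} {m : ℕ}
  {k : M → M → ℝ} {β β' η C C₀ D K r q : ℝ} {κ p : Fin m → M → ℝ} {f : M → ℝ}

/-- The remainder estimate in the Taylor formula at `x₀`, for the gap `V(R) ≥ 2 V(r)` and with
`R = d(x₀, x)`. -/
def TaylorRemainderLe (μ : Measure M) (k : M → M → ℝ) (β : ℝ) (x₀ : M) (η : ℝ)
    (κ p : Fin m → M → ℝ) (C : ℝ) : Prop :=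
  ∀ r, 0 < vol μ x₀ r → ∀ x, 2 * vol μ x₀ r ≤ vol μ x₀ (dist x₀ x) → ∀ y ∈ closedBall x₀ r,
    |k x y - ∑ j, κ j x * p j y| ≤ C * vol μ x₀ r ^ η * invVol μ x₀ x ^ (η + 1 / β)

theorem HasTaylorFormulaAt.exists_isTaylorSystem (hv : HasContinuousVolume μ) (hη : 0 ≤ η)
    (hy : HasTaylorFormulaAt μ k β x₀ η) :
    ∃ (m : ℕ) (κ p : Fin m → M → ℝ) (C C₀ : ℝ),
      IsTaylorSystem μ x₀ p C ∧ 0 ≤ C₀ ∧ TaylorRemainderLe μ k β x₀ η κ p C₀ := by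
  obtain ⟨m, -, κ, p, -, hpm, hpb, hpi, hT, C, hC⟩ := hy
  obtain ⟨C₀, hC₀⟩ := hT 1 one_pos
  refine ⟨m, κ, p, C, |C₀|, ⟨hpm, hpb, hpi, hC⟩, abs_nonneg _, fun r hr x hx y hy => ?_⟩
  have hxpos : 0 < vol μ x₀ (dist x₀ x) := by linarith
  have hrem := hC₀ r (hv.pos_of_vol_pos hr) (dist x₀ x) (hv.pos_of_vol_pos hxpos) (by linarith)
    x y hy (dist_comm x₀ x).le (by rwa [dist_comm])
  rw [dist_comm x x₀, show -η - 1 / β = -(η + 1 / β) by ring, Real.rpow_neg hxpos.le,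
    ← Real.inv_rpow hxpos.le] at hrem
  have hmono : vol μ x₀ (dist y x₀) ^ η ≤ vol μ x₀ r ^ η :=
    Real.rpow_le_rpow (vol_nonneg _ _) (hv.vol_mono x₀ hy) hη
  have := vol_nonneg (μ := μ) x₀ (dist y x₀)
  refine hrem.trans ?_
  rw [invVol]
  gcongr
  exact le_abs_self _

theorem HasContinuousVolume.setLIntegral_invVol_rpow_le [OpensMeasurableSpace M]
    (hv : HasContinuousVolume μ) (hβ : β.HolderConjugate β') (hr : 0 < vol μ x₀ r) :
    ∫⁻ y in closedBall x₀ r, ENNReal.ofReal (invVol μ x₀ y ^ (1 / β)) ∂μ ≤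
      ENNReal.ofReal (β' * vol μ x₀ r ^ (1 / β')) := by
  have hconst : 1 + 1 / (β - 1) = β' := by
    have := hβ.sub_one_ne_zero
    rw [hβ.conjugate_eq]
    field_simp
    ring
  have hball := (hv.weakL1With_invVol x₀).setLIntegral_rpow_one_div_le zero_le_one
    (hv.measurable_invVol x₀) (invVol_nonneg x₀) hβ hr (hv.ofReal_vol x₀ r).ge
  rwa [hconst] at hball

theorem HasContinuousVolume.setLIntegral_enorm_le [OpensMeasurableSpace M]
    (hv : HasContinuousVolume μ) (hβ : β.HolderConjugate β') (hD : 0 ≤ D) (hr : 0 < vol μ x₀ r)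
    (hf : ∀ᵐ y ∂μ, |f y| ≤ D * invVol μ x₀ y ^ (1 / β')) :
    ∫⁻ y in closedBall x₀ r, ‖f y‖ₑ ∂μ ≤ ENNReal.ofReal (D * (β * vol μ x₀ r ^ (1 / β))) :=
  calc _ ≤ ∫⁻ y in closedBall x₀ r,
          ENNReal.ofReal D * ENNReal.ofReal (invVol μ x₀ y ^ (1 / β')) ∂μ := by
        refine lintegral_mono_ae ?_
        filter_upwards [ae_restrict_of_ae hf] with y hy
        rw [← ENNReal.ofReal_mul hD, ← ofReal_norm]
        exact ENNReal.ofReal_le_ofReal hy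
    _ ≤ _ := by
        rw [lintegral_const_mul' _ _ ENNReal.ofReal_ne_top, ENNReal.ofReal_mul hD]
        gcongr
        exact hv.setLIntegral_invVol_rpow_le hβ.symm hr

/-- Functions on the ball `B(x₀, r)` which are dominated by `D V^{-1/β'}` and orthogonal to the
`p j`. The cancellation makes their potentials small away from `x₀`. -/
structure IsCancellingAtom (μ : Measure M) (β' : ℝ) (x₀ : M) (p : Fin m → M → ℝ) (D r : ℝ)
    (f : M → ℝ) : Prop where
  measurable : Measurable f
  support_subset : Function.support f ⊆ closedBall x₀ r
  abs_le : ∀ᵐ y ∂μ, |f y| ≤ D * invVol μ x₀ y ^ (1 / β')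
  moment_eq_zero : ∀ j, ∫ y, p j y * f y ∂μ = 0

namespace IsCancellingAtom

theorem setLIntegral_closedBall (hf : IsCancellingAtom μ β' x₀ p D r f) (g : M → ℝ) :
    ∫⁻ y in closedBall x₀ r, ‖g y * f y‖ₑ ∂μ = ∫⁻ y, ‖g y * f y‖ₑ ∂μ := by
  refine setLIntegral_eq_of_support_subset fun y hy => hf.support_subset ?_
  simp_all

theorem setLIntegral_potential_near_le (hf : IsCancellingAtom μ β' x₀ p D r f) (hD : 0 ≤ D)
    (hq : 0 ≤ q) (E : Set M) :
    ∫⁻ x in E, ‖potential μ k f x‖ₑ ^ q ∂μ ≤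
      ENNReal.ofReal (D ^ q) * ∫⁻ x in E, (∫⁻ y in closedBall x₀ r,
        ‖k x y‖ₑ * ENNReal.ofReal (invVol μ x₀ y ^ (1 / β')) ∂μ) ^ q ∂μ := by
  have hpot (x : M) : ‖potential μ k f x‖ₑ ≤ ENNReal.ofReal D * ∫⁻ y in closedBall x₀ r,
      ‖k x y‖ₑ * ENNReal.ofReal (invVol μ x₀ y ^ (1 / β')) ∂μ := by
    refine (enorm_integral_le_lintegral_enorm _).trans ?_
    rw [← hf.setLIntegral_closedBall (k x), ← lintegral_const_mul' _ _ ENNReal.ofReal_ne_top]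
    refine lintegral_mono_ae ?_
    filter_upwards [ae_restrict_of_ae hf.abs_le] with y hy
    rw [enorm_mul, mul_left_comm, ← ENNReal.ofReal_mul hD, ← ofReal_norm (f y)]
    gcongr
    exact hy
  calc _ ≤ ∫⁻ x in E, (ENNReal.ofReal D * ∫⁻ y in closedBall x₀ r,
          ‖k x y‖ₑ * ENNReal.ofReal (invVol μ x₀ y ^ (1 / β')) ∂μ) ^ q ∂μ :=
        lintegral_mono fun x => ENNReal.rpow_le_rpow (hpot x) hq
    _ = _ := by
        simp_rw [ENNReal.mul_rpow_of_nonneg _ _ hq, ENNReal.ofReal_rpow_of_nonneg hD hq]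
        rw [lintegral_const_mul' _ _ ENNReal.ofReal_ne_top]

variable [OpensMeasurableSpace M]

theorem lintegral_enorm_le (hf : IsCancellingAtom μ β' x₀ p D r f) (hv : HasContinuousVolume μ)
    (hβ : β.HolderConjugate β') (hD : 0 ≤ D) (hr : 0 < vol μ x₀ r) :
    ∫⁻ y, ‖f y‖ₑ ∂μ ≤ ENNReal.ofReal (D * (β * vol μ x₀ r ^ (1 / β))) := by
  have hball := hf.setLIntegral_closedBall fun _ => 1
  simp only [one_mul] at hball
  exact hball ▸ hv.setLIntegral_enorm_le hβ hD hr hf.abs_le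

theorem integrable (hf : IsCancellingAtom μ β' x₀ p D r f) (hv : HasContinuousVolume μ)
    (hβ : 1 < β') (hD : 0 ≤ D) (hr : 0 < vol μ x₀ r) : Integrable f μ :=
  ⟨hf.measurable.aestronglyMeasurable,
    (hf.lintegral_enorm_le hv (Real.HolderConjugate.conjExponent hβ).symm hD hr).trans_lt
      ENNReal.ofReal_lt_top⟩

theorem integral_abs_le (hf : IsCancellingAtom μ β' x₀ p D r f) (hv : HasContinuousVolume μ)
    (hβ : β.HolderConjugate β') (hD : 0 ≤ D) (hr : 0 < vol μ x₀ r) :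
    ∫ y, |f y| ∂μ ≤ D * (β * vol μ x₀ r ^ (1 / β)) := by
  have := hβ.pos
  simp_rw [← Real.norm_eq_abs]
  rw [integral_norm_eq_lintegral_enorm hf.measurable.aestronglyMeasurable]
  exact ENNReal.toReal_le_of_le_ofReal (by positivity) (hf.lintegral_enorm_le hv hβ hD hr)

theorem potential_eq_integral_sub (hf : IsCancellingAtom μ β' x₀ p D r f)
    (hv : HasContinuousVolume μ) (hp : IsTaylorSystem μ x₀ p C) (hβ : 1 < β') (hD : 0 ≤ D)
    (hr : 0 < vol μ x₀ r) (hkm : Measurable (Function.uncurry k)) {x : M} {a : Fin m → ℝ} {B : ℝ}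
    (hB : ∀ y ∈ closedBall x₀ r, |k x y - ∑ j, a j * p j y| ≤ B) :
    potential μ k f x = ∫ y, (k x y - ∑ j, a j * p j y) * f y ∂μ := by
  have hfi := hf.integrable hv hβ hD hr
  have hrem : Integrable (fun y => (k x y - ∑ j, a j * p j y) * f y) μ :=
    integrable_mul_of_support_subset hfi
      (hkm.of_uncurry_left.sub (Finset.measurable_fun_sum _ fun j _ =>
        (hp.measurable j).const_mul _)) hf.support_subset hB
  have hpf (j : Fin m) : Integrable (fun y => a j * (p j y * f y)) μ := by
    obtain ⟨B', hB'⟩ := hp.bounded r (hv.pos_of_vol_pos hr) j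
    exact (integrable_mul_of_support_subset hfi (hp.measurable j) hf.support_subset hB').const_mul _
  calc _ = ∫ y, (k x y - ∑ j, a j * p j y) * f y + ∑ j, a j * (p j y * f y) ∂μ := by
        refine integral_congr_ae (.of_forall fun y => ?_)
        simp only [sub_mul, Finset.sum_mul, mul_assoc, sub_add_cancel]
    _ = _ := by
        rw [integral_add hrem (integrable_finsetSum _ fun j _ => hpf j),
          integral_finsetSum _ fun j _ => hpf j]
        simp [integral_const_mul, hf.moment_eq_zero]

theorem abs_potential_le (hf : IsCancellingAtom μ β' x₀ p D r f) (hv : HasContinuousVolume μ)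
    (hp : IsTaylorSystem μ x₀ p C) (hβ : β.HolderConjugate β') (hD : 0 ≤ D)
    (hr : 0 < vol μ x₀ r) (hkm : Measurable (Function.uncurry k)) (hC₀ : 0 ≤ C₀)
    (hT : TaylorRemainderLe μ k β x₀ η κ p C₀) {x : M}
    (hx : 2 * vol μ x₀ r ≤ vol μ x₀ (dist x₀ x)) :
    |potential μ k f x| ≤
      C₀ * D * β * (vol μ x₀ r ^ (η + 1 / β) * invVol μ x₀ x ^ (η + 1 / β)) := by
  set B := C₀ * vol μ x₀ r ^ η * invVol μ x₀ x ^ (η + 1 / β) with hB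
  have hrem := hT r hr x hx
  have := invVol_nonneg (μ := μ) x₀ x
  have hpot := hf.potential_eq_integral_sub hv hp hβ.symm.lt hD hr hkm hrem
  calc |potential μ k f x| ≤ ∫ y, B * |f y| ∂μ := by
        rw [hpot, ← Real.norm_eq_abs]
        refine norm_integral_le_of_norm_le
          ((hf.integrable hv hβ.symm.lt hD hr).abs.const_mul B) (.of_forall fun y => ?_)
        by_cases hy : y ∈ closedBall x₀ r
        · exact (norm_mul_le _ _).trans (mul_le_mul_of_nonneg_right (hrem y hy) (abs_nonneg _))
        · simp [Function.notMem_support.1 fun h => hy (hf.support_subset h)]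
    _ ≤ B * (D * (β * vol μ x₀ r ^ (1 / β))) := by
        rw [integral_const_mul]
        gcongr
        exact hf.integral_abs_le hv hβ hD hr
    _ = _ := by
        rw [hB, Real.rpow_add hr]
        ring

theorem setLIntegral_potential_far_le (hf : IsCancellingAtom μ β' x₀ p D r f)
    (hv : HasContinuousVolume μ) (hp : IsTaylorSystem μ x₀ p C) (hβ : β.HolderConjugate β')
    (hD : 0 ≤ D) (hr : 0 < vol μ x₀ r) (hkm : Measurable (Function.uncurry k)) (hC₀ : 0 ≤ C₀)
    (hT : TaylorRemainderLe μ k β x₀ η κ p C₀) (hq : 0 < q) {b : ℝ} (hb : b = (η + 1 / β) * q)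
    (hb1 : 1 < b) :
    ∫⁻ x in {x | 2 * vol μ x₀ r ≤ vol μ x₀ (dist x₀ x)}, ‖potential μ k f x‖ₑ ^ q ∂μ ≤
      ENNReal.ofReal ((C₀ * D * β) ^ q * (b / (b - 1) * 2 ^ (-(b - 1))) * vol μ x₀ r) := by
  set ρ := vol μ x₀ r
  have hβ0 := hβ.pos
  set c := C₀ * D * β
  have hc : 0 ≤ c := by positivity
  have : 0 < b - 1 := by linarith
  have hfar : MeasurableSet {x | 2 * ρ ≤ vol μ x₀ (dist x₀ x)} :=
    measurableSet_le measurable_const (hv.measurable_vol_dist x₀)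
  have hpoint : ∀ x ∈ {x | 2 * ρ ≤ vol μ x₀ (dist x₀ x)}, ‖potential μ k f x‖ₑ ^ q ≤
      ENNReal.ofReal (c ^ q * ρ ^ b) * ENNReal.ofReal (invVol μ x₀ x ^ b) := fun x hx => by
    have hinv := invVol_nonneg (μ := μ) x₀ x
    rw [← ENNReal.ofReal_mul (by positivity), ← ofReal_norm,
      ENNReal.ofReal_rpow_of_nonneg (norm_nonneg _) hq.le, hb, Real.rpow_mul hr.le,
      Real.rpow_mul hinv, mul_assoc, ← Real.mul_rpow (by positivity) (by positivity),
      ← Real.mul_rpow hc (by positivity)]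
    gcongr
    exact hf.abs_potential_le hv hp hβ hD hr hkm hC₀ hT hx
  calc _ ≤ ENNReal.ofReal (c ^ q * ρ ^ b) *
          ENNReal.ofReal (1 * b / (b - 1) * (2 * ρ)⁻¹ ^ (b - 1)) := by
        refine (setLIntegral_mono' hfar hpoint).trans ?_
        rw [lintegral_const_mul' _ _ ENNReal.ofReal_ne_top]
        gcongr
        have hsub : {x | 2 * ρ ≤ vol μ x₀ (dist x₀ x)} ⊆ {x | invVol μ x₀ x ≤ (2 * ρ)⁻¹} :=
          fun x hx => inv_anti₀ (mul_pos two_pos hr) hx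
        exact (lintegral_mono_set hsub).trans
          ((hv.weakL1With_invVol x₀).setLIntegral_rpow_le_of_le zero_le_one
            (hv.measurable_invVol x₀) (invVol_nonneg x₀) hb1 (T := (2 * ρ)⁻¹) (by positivity))
    _ = _ := by
        have hρb : ρ ^ b * ρ ^ (-(b - 1)) = ρ := by
          rw [← Real.rpow_add hr, show b + -(b - 1) = 1 by ring, Real.rpow_one]
        rw [← ENNReal.ofReal_mul (by positivity), Real.inv_rpow (by positivity),
          ← Real.rpow_neg (by positivity), Real.mul_rpow zero_le_two hr.le]
        congr 1
        linear_combination (c ^ q * (b / (b - 1) * 2 ^ (-(b - 1)))) * hρb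

theorem exists_normPow_potential_le (hv : HasContinuousVolume μ) (hk : HasWeakType μ k β K)
    (hβ : β.HolderConjugate β') (hp : IsTaylorSystem μ x₀ p C) (hC₀ : 0 ≤ C₀)
    (hT : TaylorRemainderLe μ k β x₀ η κ p C₀) (hD : 0 ≤ D) (hq : 0 < q)
    (hqη : 1 < (η + 1 / β) * q) :
    ∃ C ≥ 0, ∀ r, 0 < vol μ x₀ r → ∀ f, IsCancellingAtom μ β' x₀ p D r f →
      normPow μ q (potential μ k f) ≤ ENNReal.ofReal (C * vol μ x₀ r) := by
  have : Nonempty M := ⟨x₀⟩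
  have : SigmaFinite μ := hv.sigmaFinite
  obtain ⟨C₁, hC₁, hnear⟩ := hk.lintegral_rpow_lintegral_mul_rpow_le hβ (hv.weakL1With_invVol x₀)
    zero_le_one (hv.measurable_invVol x₀) (invVol_nonneg x₀) hq.le
  set b := (η + 1 / β) * q with hb
  have : 0 < b - 1 := by linarith
  have hβ0 := hβ.pos
  refine ⟨D ^ q * C₁ + (C₀ * D * β) ^ q * (b / (b - 1) * 2 ^ (-(b - 1))), by positivity,
    fun r hr f hf => ?_⟩
  have hE : MeasurableSet {x | 2 * vol μ x₀ r ≤ vol μ x₀ (dist x₀ x)} :=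
    measurableSet_le measurable_const (hv.measurable_vol_dist x₀)
  have hE_compl : μ {x | 2 * vol μ x₀ r ≤ vol μ x₀ (dist x₀ x)}ᶜ ≤
      ENNReal.ofReal (2 * vol μ x₀ r) := by
    refine (measure_mono fun x hx => ?_).trans (hv.measure_vol_dist_le x₀ (by positivity))
    rw [mem_compl_iff, mem_ofPred_eq, not_le] at hx
    exact hx.le
  rw [normPow_eq_lintegral μ hq, ← lintegral_add_compl _ hE, add_comm, add_mul,
    ENNReal.ofReal_add (by positivity) (by positivity)]
  refine add_le_add ((hf.setLIntegral_potential_near_le hD hq.le _).trans ?_)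
    (hf.setLIntegral_potential_far_le hv hp hβ hD hr hk.measurable hC₀ hT hq hb hqη)
  rw [mul_assoc, ENNReal.ofReal_mul (by positivity)]
  gcongr
  exact hnear _ hr _ _ hE_compl (hv.ofReal_vol x₀ r).ge

end IsCancellingAtom

end

/-! ### The extremal functions -/

theorem add_rpow_le_rpow_add_mul {s x y : ℝ} (hs : 1 ≤ s) (hx : 0 ≤ x) (hy : 0 ≤ y) :
    (x + y) ^ s ≤ x ^ s + s * (y * (x + y) ^ (s - 1)) := by
  rcases (add_nonneg hx hy).eq_or_lt with h | h
  · rw [← h, Real.zero_rpow (by linarith)]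
    positivity
  have hquot : 1 + -(y / (x + y)) = x / (x + y) := by field_simp; ring
  have bernoulli := one_add_mul_self_le_rpow_one_add (s := -(y / (x + y)))
    (by rw [neg_le_neg_iff, div_le_one h]; linarith) hs
  rw [hquot, Real.div_rpow hx h.le, le_div_iff₀ (by positivity)] at bernoulli
  have hpow : y / (x + y) * (x + y) ^ s = y * (x + y) ^ (s - 1) := by
    rw [Real.rpow_sub_one h.ne']
    field_simp
  linear_combination bernoulli + s * hpow

theorem add_rpow_le_two_rpow_mul {s x y : ℝ} (hs : 0 ≤ s) (hx : 0 ≤ x) (hy : 0 ≤ y) :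
    (x + y) ^ s ≤ 2 ^ s * (x ^ s + y ^ s) := by
  wlog hxy : x ≤ y generalizing x y
  · rw [add_comm x, add_comm (x ^ s)]
    exact this hy hx (not_le.1 hxy).le
  calc (x + y) ^ s ≤ (2 * y) ^ s := Real.rpow_le_rpow (by positivity) (by linarith) hs
    _ = 2 ^ s * y ^ s := Real.mul_rpow zero_le_two hy
    _ ≤ _ := by
        gcongr
        exact le_add_of_nonneg_left (by positivity)

theorem abs_sub_rpow_le {s : ℝ} (hs : 1 ≤ s) (a b : ℝ) :
    |a - b| ^ s ≤ |a| ^ s + s * 2 ^ (s - 1) * (|b| * |a| ^ (s - 1) + |b| ^ s) := by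
  have hs0 : 0 ≤ s - 1 := by linarith
  have hpow : |b| * |b| ^ (s - 1) = |b| ^ s := by
    rw [mul_comm, ← Real.rpow_add_one' (abs_nonneg b) (by linarith), sub_add_cancel]
  calc |a - b| ^ s ≤ (|a| + |b|) ^ s :=
        Real.rpow_le_rpow (abs_nonneg _) (abs_sub a b) (by linarith)
    _ ≤ |a| ^ s + s * (|b| * (|a| + |b|) ^ (s - 1)) :=
        add_rpow_le_rpow_add_mul hs (abs_nonneg a) (abs_nonneg b)
    _ ≤ |a| ^ s + s * (|b| * (2 ^ (s - 1) * (|a| ^ (s - 1) + |b| ^ (s - 1)))) := by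
        gcongr
        exact add_rpow_le_two_rpow_mul hs0 (abs_nonneg a) (abs_nonneg b)
    _ = _ := by rw [← hpow]; ring

theorem abs_mul_abs_rpow_sub_two {β : ℝ} (hβ : 1 < β) (t : ℝ) :
    |t * |t| ^ (β - 2)| = |t| ^ (β - 1) := by
  rw [abs_mul, Real.abs_rpow_of_nonneg (abs_nonneg t), abs_abs, mul_comm,
    ← Real.rpow_add_one' (abs_nonneg t) (by linarith)]
  congr 1
  ring

theorem mul_self_mul_abs_rpow_sub_two {β : ℝ} (hβ : 1 < β) (t : ℝ) :
    t * (t * |t| ^ (β - 2)) = |t| ^ β := by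
  rw [← mul_assoc, ← abs_mul_abs_self t, mul_assoc, mul_comm |t| (_ ^ _),
    ← Real.rpow_add_one' (abs_nonneg t) (by linarith), mul_comm,
    ← Real.rpow_add_one' (abs_nonneg t) (by linarith)]
  congr 1
  ring

section DualDensity

variable {M : Type*} [MetricSpace M] {k : M → M → ℝ} {β β' B : ℝ} {x : M} {r₁ r₂ : ℝ}

/-- The density `sgn(k(x,y)) |k(x,y)|^{β-1}` on an annulus around `x`: up to scaling, the extremal
in Hölder's inequality between `L^β` and `L^{β'}` for `k(x,·)` restricted to the annulus. -/
def dualDensity (k : M → M → ℝ) (β : ℝ) (x : M) (r₁ r₂ : ℝ) : M → ℝ :=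
  indicator {y | r₁ ≤ dist x y ∧ dist x y ≤ r₂} fun y => k x y * |k x y| ^ (β - 2)

theorem support_dualDensity_subset (k : M → M → ℝ) (β : ℝ) (x : M) (r₁ r₂ : ℝ) :
    Function.support (dualDensity k β x r₁ r₂) ⊆ closedBall x r₂ := fun y hy => by
  rw [mem_closedBall, dist_comm]
  exact (support_indicator_subset hy).2

theorem abs_dualDensity_rpow (hβ : β.HolderConjugate β') (y : M) :
    |dualDensity k β x r₁ r₂ y| ^ β' =
      indicator {y | r₁ ≤ dist x y ∧ dist x y ≤ r₂} (fun y => |k x y| ^ β) y := by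
  rw [dualDensity, indicator_apply, indicator_apply]
  split_ifs
  · rw [abs_mul_abs_rpow_sub_two hβ.lt, ← Real.rpow_mul (abs_nonneg _), hβ.sub_one_mul_conj]
  · rw [abs_zero, Real.zero_rpow hβ.symm.ne_zero]

theorem mul_dualDensity (hβ : 1 < β) (y : M) :
    k x y * dualDensity k β x r₁ r₂ y =
      indicator {y | r₁ ≤ dist x y ∧ dist x y ≤ r₂} (fun y => |k x y| ^ β) y := by
  rw [dualDensity, indicator_apply, indicator_apply]
  split_ifs
  · exact mul_self_mul_abs_rpow_sub_two hβ _
  · exact mul_zero _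

variable [MeasurableSpace M] {μ : Measure M}

theorem abs_dualDensity_le (hβ : β.HolderConjugate β') (hB : 0 ≤ B)
    (hb : ∀ y, r₁ ≤ dist x y → dist x y ≤ r₂ → |k x y| ≤ B * invVol μ x y ^ (1 / β))
    (y : M) : |dualDensity k β x r₁ r₂ y| ≤ B ^ (β - 1) * invVol μ x y ^ (1 / β') := by
  have := invVol_nonneg (μ := μ) x y
  rw [dualDensity, indicator_apply]
  split_ifs with hy
  · have hexp : 1 / β * (β - 1) = 1 / β' := by
      rw [hβ.conjugate_eq]
      field_simp
    rw [abs_mul_abs_rpow_sub_two hβ.lt, ← hexp, Real.rpow_mul this,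
      ← Real.mul_rpow hB (by positivity)]
    exact Real.rpow_le_rpow (abs_nonneg _) (hb y hy.1 hy.2) hβ.sub_one_pos.le
  · rw [abs_zero]
    positivity

theorem abs_dualDensity_le_const (hβ : β.HolderConjugate β') (hB : 0 ≤ B)
    (hv : HasContinuousVolume μ) (hr₁ : 0 < vol μ x r₁)
    (hb : ∀ y, r₁ ≤ dist x y → dist x y ≤ r₂ → |k x y| ≤ B * invVol μ x y ^ (1 / β))
    (y : M) : |dualDensity k β x r₁ r₂ y| ≤ B ^ (β - 1) * (vol μ x r₁)⁻¹ ^ (1 / β') := by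
  by_cases hy : y ∈ {y | r₁ ≤ dist x y ∧ dist x y ≤ r₂}
  · refine (abs_dualDensity_le hβ hB hb y).trans ?_
    have := invVol_nonneg (μ := μ) x y
    have := hβ.symm.one_div_nonneg
    gcongr
    exact inv_anti₀ hr₁ (hv.vol_mono x hy.1)
  · rw [dualDensity, indicator_of_notMem hy, abs_zero]
    positivity

theorem HasContinuousVolume.annulusIntegral_ne_top (hv : HasContinuousVolume μ) (hβ : 0 ≤ β)
    (hr₁ : 0 < vol μ x r₁)
    (hb : ∀ y, r₁ ≤ dist x y → dist x y ≤ r₂ → |k x y| ≤ B * invVol μ x y ^ (1 / β)) :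
    annulusIntegral μ k β x r₁ r₂ ≠ ∞ := by
  have hsub : {y | r₁ ≤ dist x y ∧ dist x y ≤ r₂} ⊆ closedBall x r₂ := fun y hy => by
    rw [mem_closedBall, dist_comm]
    exact hy.2
  refine (setLIntegral_lt_top_of_le_nnreal
    ((measure_mono hsub).trans_lt (hv.finite x r₂)).ne
    ⟨((|B| * (vol μ x r₁)⁻¹ ^ (1 / β)) ^ β).toNNReal, fun y hy => ?_⟩).ne
  have := invVol_nonneg (μ := μ) x y
  have hinv : invVol μ x y ≤ (vol μ x r₁)⁻¹ := inv_anti₀ hr₁ (hv.vol_mono x hy.1)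
  refine ENNReal.ofReal_le_ofReal (Real.rpow_le_rpow (abs_nonneg _) ((hb y hy.1 hy.2).trans ?_) hβ)
  gcongr
  exact le_abs_self B

theorem HasWeakType.integrableOn_closedBall {K : ℝ} (hk : HasWeakType μ k β K)
    (hv : HasContinuousVolume μ) (hβ : 1 < β) {r : ℝ} (hr : 0 < vol μ x r) (z : M) :
    IntegrableOn (k z) (closedBall x r) μ :=
  ⟨hk.measurable.of_uncurry_left.aestronglyMeasurable,
    (hk.setLIntegral_enorm_le (Real.HolderConjugate.conjExponent hβ) z hr
      (hv.ofReal_vol x r).ge).trans_lt ENNReal.ofReal_lt_top⟩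

variable [OpensMeasurableSpace M]

theorem measurableSet_annulus (x : M) (r₁ r₂ : ℝ) :
    MeasurableSet {y | r₁ ≤ dist x y ∧ dist x y ≤ r₂} :=
  (isClosed_le continuous_const (continuous_const.dist continuous_id)).measurableSet.inter
    (isClosed_le (continuous_const.dist continuous_id) continuous_const).measurableSet

theorem measurable_dualDensity (hk : Measurable (Function.uncurry k)) (β : ℝ) (x : M)
    (r₁ r₂ : ℝ) : Measurable (dualDensity k β x r₁ r₂) :=
  (hk.of_uncurry_left.mul (hk.of_uncurry_left.abs.pow_const _)).indicator
    (measurableSet_annulus x r₁ r₂)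

theorem normPow_dualDensity (μ : Measure M) (k : M → M → ℝ) (hβ : β.HolderConjugate β') (x : M)
    (r₁ r₂ : ℝ) :
    normPow μ β' (dualDensity k β x r₁ r₂) = annulusIntegral μ k β x r₁ r₂ := by
  rw [normPow_eq_lintegral μ hβ.symm.pos, annulusIntegral,
    ← lintegral_indicator (measurableSet_annulus x r₁ r₂)]
  congr with y
  rw [← ofReal_norm, Real.norm_eq_abs, ENNReal.ofReal_rpow_of_nonneg (abs_nonneg _)
    hβ.symm.nonneg, abs_dualDensity_rpow hβ, indicator_apply, indicator_apply]
  split_ifs <;> simp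

theorem potential_dualDensity (hk : Measurable (Function.uncurry k)) (hβ : 1 < β) (x : M)
    (r₁ r₂ : ℝ) :
    potential μ k (dualDensity k β x r₁ r₂) x = (annulusIntegral μ k β x r₁ r₂).toReal := by
  simp_rw [potential, mul_dualDensity hβ]
  rw [integral_indicator (measurableSet_annulus x r₁ r₂), annulusIntegral,
    integral_eq_lintegral_of_nonneg_ae (.of_forall fun y => by positivity)
      (hk.of_uncurry_left.abs.pow_const β).aestronglyMeasurable]

end DualDensity

section Extremal

variable {M : Type*} [MetricSpace M] [MeasurableSpace M] {μ : Measure M} {x₀ : M} {m : ℕ}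
  {k : M → M → ℝ} {β β' η C D E K r s : ℝ} {p : Fin m → M → ℝ} {f b : M → ℝ}

/-- Pointwise regularity of order `η` in the first variable at `x₀`, for the gap
`V(d(x₀, y)) > 2 V(s)` and with an explicit constant. -/
def XRegularWith (μ : Measure M) (k : M → M → ℝ) (β : ℝ) (x₀ : M) (η C : ℝ) : Prop :=
  ∀ s, 0 < vol μ x₀ s → ∀ x ∈ closedBall x₀ s, ∀ y, 2 * vol μ x₀ s < vol μ x₀ (dist x₀ y) →
    |k x y - k x₀ y| ≤ C * vol μ x₀ s ^ η * invVol μ x₀ y ^ (η + 1 / β)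

theorem IsXRegularAt.exists_xRegularWith (hx : IsXRegularAt μ k β x₀ η)
    (hv : HasContinuousVolume μ) (hη : 0 ≤ η) : ∃ C ≥ 0, XRegularWith μ k β x₀ η C := by
  obtain ⟨C, hC⟩ := hx 1 one_pos
  refine ⟨|C|, abs_nonneg C, fun s hs x hxs y hy => ?_⟩
  have hypos : 0 < vol μ x₀ (dist x₀ y) := by linarith
  obtain ⟨R, hR⟩ := hv.exists_vol_eq (x := x₀) (by positivity) hy.le
  have hRy : R < dist x₀ y := hv.lt_of_vol_lt (by rwa [hR])
  have hreg := hC s (hv.pos_of_vol_pos hs) R (hv.pos_of_vol_pos (x := x₀) (by rw [hR]; positivity))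
    (by rw [hR]; linarith) x hxs y (by rwa [mem_closedBall, dist_comm, not_le]) hypos
  rw [show -η - 1 / β = -(η + 1 / β) by ring, Real.rpow_neg hypos.le,
    ← Real.inv_rpow hypos.le] at hreg
  have hxs' : vol μ x₀ (dist x₀ x) ≤ vol μ x₀ s := hv.vol_mono x₀ (by rwa [dist_comm])
  have := vol_nonneg (μ := μ) x₀ (dist x₀ x)
  refine hreg.trans ?_
  rw [invVol]
  gcongr
  exact le_abs_self C

theorem abs_sub_rpow_le_of_le (hβ : β.HolderConjugate β') (hD : 0 ≤ D) (hE : 0 ≤ E)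
    {u v h ρ : ℝ} (hh : 0 ≤ h) (hρ : 0 < ρ) (hu : |u| ≤ D * h ^ (1 / β'))
    (hv : |v| ≤ E * ρ ^ (-(1 / β'))) :
    |u - v| ^ β' ≤ |u| ^ β' + (β' * 2 ^ (β' - 1) * (E * D ^ (β' - 1)) * ρ ^ (-(1 / β')) *
      h ^ (1 / β) + β' * 2 ^ (β' - 1) * E ^ β' * ρ⁻¹) := by
  have hβ0 := hβ.symm.pos
  have hexp : 1 / β' * (β' - 1) = 1 / β := by
    rw [hβ.symm.conjugate_eq]
    field_simp
  have hu' : |u| ^ (β' - 1) ≤ D ^ (β' - 1) * h ^ (1 / β) := by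
    rw [← hexp, Real.rpow_mul hh, ← Real.mul_rpow hD (by positivity)]
    exact Real.rpow_le_rpow (abs_nonneg _) hu hβ.symm.sub_one_pos.le
  have hv' : |v| ^ β' ≤ E ^ β' * ρ⁻¹ := by
    rw [← Real.rpow_neg_one, show (-1 : ℝ) = -(1 / β') * β' by field_simp, Real.rpow_mul hρ.le,
      ← Real.mul_rpow hE (by positivity)]
    exact Real.rpow_le_rpow (abs_nonneg _) hv hβ0.le
  calc |u - v| ^ β' ≤ |u| ^ β' + β' * 2 ^ (β' - 1) * (|v| * |u| ^ (β' - 1) + |v| ^ β') :=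
        abs_sub_rpow_le hβ.symm.lt.le u v
    _ ≤ |u| ^ β' + β' * 2 ^ (β' - 1) * (E * ρ ^ (-(1 / β')) *
          (D ^ (β' - 1) * h ^ (1 / β)) + E ^ β' * ρ⁻¹) := by gcongr
    _ = _ := by ring

theorem enorm_sub_rpow_le_of_le (hβ : β.HolderConjugate β') (hD : 0 ≤ D) (hE : 0 ≤ E)
    {u v h ρ : ℝ} (hh : 0 ≤ h) (hρ : 0 < ρ) (hu : |u| ≤ D * h ^ (1 / β'))
    (hv : |v| ≤ E * ρ ^ (-(1 / β'))) :
    ‖u - v‖ₑ ^ β' ≤ ‖u‖ₑ ^ β' +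
      (ENNReal.ofReal (β' * 2 ^ (β' - 1) * (E * D ^ (β' - 1)) * ρ ^ (-(1 / β'))) *
        ENNReal.ofReal (h ^ (1 / β)) + ENNReal.ofReal (β' * 2 ^ (β' - 1) * E ^ β' * ρ⁻¹)) := by
  have hβ0 := hβ.symm.pos
  rw [← ofReal_norm, ← ofReal_norm, ENNReal.ofReal_rpow_of_nonneg (norm_nonneg _) hβ0.le,
    ENNReal.ofReal_rpow_of_nonneg (norm_nonneg _) hβ0.le, ← ENNReal.ofReal_mul (by positivity),
    ← ENNReal.ofReal_add (by positivity) (by positivity),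
    ← ENNReal.ofReal_add (by positivity) (by positivity)]
  exact ENNReal.ofReal_le_ofReal (abs_sub_rpow_le_of_le hβ hD hE hh hρ hu hv)

theorem XRegularWith.abs_sub_mul_le (hx : XRegularWith μ k β x₀ η C)
    (hβ : β.HolderConjugate β') (hC : 0 ≤ C) (hs : 0 < vol μ x₀ s) {x y : M}
    (hxs : x ∈ closedBall x₀ s) (hy : 2 * vol μ x₀ s < vol μ x₀ (dist x₀ y)) {t : ℝ}
    (ht : |t| ≤ D * invVol μ x₀ y ^ (1 / β')) :
    |(k x y - k x₀ y) * t| ≤ C * D * vol μ x₀ s ^ η * invVol μ x₀ y ^ (1 + η) := by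
  have hexp : 1 + η = η + 1 / β + 1 / β' := by
    simp only [one_div]
    linarith [hβ.inv_add_inv_eq_one]
  have hy0 : 0 < invVol μ x₀ y := inv_pos.2 (by linarith)
  calc |(k x y - k x₀ y) * t| ≤ C * vol μ x₀ s ^ η * invVol μ x₀ y ^ (η + 1 / β) *
          (D * invVol μ x₀ y ^ (1 / β')) := by
        rw [abs_mul]
        exact mul_le_mul (hx s hs x hxs y hy) ht (abs_nonneg _) (by positivity)
    _ = _ := by
        rw [hexp, Real.rpow_add hy0 (η + 1 / β)]
        ring

theorem HasWeakType.integrable_mul (hk : HasWeakType μ k β K) (hv : HasContinuousVolume μ)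
    (hβ : 1 < β) (hr : 0 < vol μ x₀ r) (hfm : Measurable f)
    (hs : Function.support f ⊆ closedBall x₀ r) (hf : ∀ y, |f y| ≤ C) (x : M) :
    Integrable (fun y => k x y * f y) μ := by
  have hsupp : Function.support (fun y => k x y * f y) ⊆ closedBall x₀ r := fun y hy =>
    hs (right_ne_zero_of_mul hy)
  rw [← integrableOn_iff_integrable_of_support_subset hsupp]
  exact (hk.integrableOn_closedBall hv hβ hr x).mul_bdd hfm.aestronglyMeasurable (.of_forall hf)

theorem HasWeakType.abs_potential_le (hk : HasWeakType μ k β K) (hv : HasContinuousVolume μ)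
    (hβ : β.HolderConjugate β') (hE : 0 ≤ E) (hr : 0 < vol μ x₀ r)
    (hbs : Function.support b ⊆ closedBall x₀ r)
    (hb : ∀ y, |b y| ≤ E * vol μ x₀ r ^ (-(1 / β'))) (x : M) :
    |potential μ k b x| ≤ E * (1 + K / (β - 1)) := by
  set ρ := vol μ x₀ r
  have := hβ.sub_one_pos
  have := hk.nonneg
  have hsupp : Function.support (fun y => ‖k x y * b y‖ₑ) ⊆ closedBall x₀ r := fun y hy =>
    hbs fun h0 => hy (by simp [h0])
  rw [← Real.norm_eq_abs]
  refine (norm_integral_le_lintegral_norm _).trans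
    (ENNReal.toReal_le_of_le_ofReal (by positivity) ?_)
  simp_rw [ofReal_norm]
  rw [← setLIntegral_eq_of_support_subset hsupp]
  calc _ ≤ ∫⁻ y in closedBall x₀ r, ENNReal.ofReal (E * ρ ^ (-(1 / β'))) * ‖k x y‖ₑ ∂μ := by
        refine lintegral_mono fun y => ?_
        rw [enorm_mul, mul_comm, ← ofReal_norm (b y)]
        gcongr
        exact hb y
    _ ≤ ENNReal.ofReal (E * ρ ^ (-(1 / β'))) *
          ENNReal.ofReal ((1 + K / (β - 1)) * ρ ^ (1 / β')) := by
        rw [lintegral_const_mul' _ _ ENNReal.ofReal_ne_top]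
        gcongr
        exact hk.setLIntegral_enorm_le hβ x hr (hv.ofReal_vol x₀ r).ge
    _ = _ := by
        have hρ : ρ ^ (-(1 / β')) * ρ ^ (1 / β') = 1 := by
          rw [← Real.rpow_add hr, neg_add_cancel, Real.rpow_zero]
        rw [← ENNReal.ofReal_mul (by positivity)]
        congr 1
        linear_combination E * (1 + K / (β - 1)) * hρ

theorem HasContinuousVolume.isCancellingAtom_sub (hv : HasContinuousVolume μ) (hβ : 0 ≤ β')
    (hE : 0 ≤ E) (hfm : Measurable f) (hbm : Measurable b)
    (hfs : Function.support f ⊆ closedBall x₀ r) (hbs : Function.support b ⊆ closedBall x₀ r)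
    (hf : ∀ y, |f y| ≤ D * invVol μ x₀ y ^ (1 / β'))
    (hb : ∀ y, |b y| ≤ E * vol μ x₀ r ^ (-(1 / β')))
    (hp : ∀ j, ∫ y, p j y * (f - b) y ∂μ = 0) :
    IsCancellingAtom μ β' x₀ p (D + E) r (f - b) where
  measurable := hfm.sub hbm
  support_subset := (Function.support_sub f b).trans (union_subset hfs hbs)
  abs_le := by
    filter_upwards [hv.ae_vol_dist_pos x₀] with y hy
    have hbE : |b y| ≤ E * invVol μ x₀ y ^ (1 / β') := by
      have := invVol_nonneg (μ := μ) x₀ y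
      by_cases hys : y ∈ Function.support b
      · have hyr : vol μ x₀ (dist x₀ y) ≤ vol μ x₀ r :=
          hv.vol_mono x₀ (by rw [dist_comm]; exact hbs hys)
        refine (hb y).trans ?_
        rw [Real.rpow_neg (vol_nonneg _ _), ← Real.inv_rpow (vol_nonneg _ _)]
        have := vol_nonneg (μ := μ) x₀ r
        gcongr
        exact inv_anti₀ hy hyr
      · rw [Function.notMem_support.1 hys, abs_zero]
        positivity
    calc |(f - b) y| ≤ |f y| + |b y| := abs_sub _ _
      _ ≤ D * invVol μ x₀ y ^ (1 / β') + E * invVol μ x₀ y ^ (1 / β') := add_le_add (hf y) hbE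
      _ = _ := by ring
  moment_eq_zero := hp

theorem IsCancellingAtom.mono {D' : ℝ} (hf : IsCancellingAtom μ β' x₀ p D r f) (h : D ≤ D') :
    IsCancellingAtom μ β' x₀ p D' r f where
  __ := hf
  abs_le := hf.abs_le.mono fun _ hy => hy.trans <|
    mul_le_mul_of_nonneg_right h (Real.rpow_nonneg (invVol_nonneg _ _) _)

variable [OpensMeasurableSpace M]

theorem HasContinuousVolume.normPow_sub_le (hv : HasContinuousVolume μ)
    (hβ : β.HolderConjugate β') (hD : 0 ≤ D) (hE : 0 ≤ E) (hr : 0 < vol μ x₀ r)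
    (hfm : Measurable f) (hs : Function.support (f - b) ⊆ closedBall x₀ r)
    (hf : ∀ y, |f y| ≤ D * invVol μ x₀ y ^ (1 / β'))
    (hb : ∀ y, |b y| ≤ E * vol μ x₀ r ^ (-(1 / β'))) :
    normPow μ β' (f - b) ≤ normPow μ β' f +
      ENNReal.ofReal (β' * 2 ^ (β' - 1) * (E * D ^ (β' - 1) * β' + E ^ β')) := by
  set ρ := vol μ x₀ r
  have hβ0 := hβ.symm.pos
  set c₁ := β' * 2 ^ (β' - 1) * (E * D ^ (β' - 1)) * ρ ^ (-(1 / β'))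
  set c₂ := β' * 2 ^ (β' - 1) * E ^ β' * ρ⁻¹
  have hsupp : Function.support (fun y => ‖(f - b) y‖ₑ ^ β') ⊆ closedBall x₀ r := fun y hy =>
    hs fun h0 => hy (by simp only [h0, enorm_zero, ENNReal.zero_rpow_of_pos hβ0])
  have hpoint (y : M) : ‖(f - b) y‖ₑ ^ β' ≤ ‖f y‖ₑ ^ β' +
      (ENNReal.ofReal c₁ * ENNReal.ofReal (invVol μ x₀ y ^ (1 / β)) + ENNReal.ofReal c₂) :=
    enorm_sub_rpow_le_of_le hβ hD hE (invVol_nonneg x₀ y) hr (hf y) (hb y)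
  have hρ : ρ ^ (-(1 / β')) * ρ ^ (1 / β') = 1 := by
    rw [← Real.rpow_add hr, neg_add_cancel, Real.rpow_zero]
  rw [normPow_eq_lintegral μ hβ0, normPow_eq_lintegral μ hβ0,
    ← setLIntegral_eq_of_support_subset hsupp]
  calc _ ≤ ∫⁻ y in closedBall x₀ r, ‖f y‖ₑ ^ β' +
          (ENNReal.ofReal c₁ * ENNReal.ofReal (invVol μ x₀ y ^ (1 / β)) +
            ENNReal.ofReal c₂) ∂μ := lintegral_mono hpoint
    _ ≤ ∫⁻ y, ‖f y‖ₑ ^ β' ∂μ + (ENNReal.ofReal c₁ * ENNReal.ofReal (β' * ρ ^ (1 / β')) +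
          ENNReal.ofReal c₂ * ENNReal.ofReal ρ) := by
        rw [lintegral_add_left (hfm.enorm.pow_const _), lintegral_add_right _ measurable_const,
          lintegral_const_mul' _ _ ENNReal.ofReal_ne_top, setLIntegral_const, hv.ofReal_vol]
        gcongr
        · exact Measure.restrict_le_self
        · exact hv.setLIntegral_invVol_rpow_le hβ hr
    _ = _ := by
        rw [← ENNReal.ofReal_mul (by positivity), ← ENNReal.ofReal_mul (by positivity),
          ← ENNReal.ofReal_add (by positivity) (by positivity)]
        congr 2
        rw [show c₂ * ρ = β' * 2 ^ (β' - 1) * E ^ β' from inv_mul_cancel_right₀ hr.ne' _]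
        linear_combination β' * 2 ^ (β' - 1) * (E * D ^ (β' - 1)) * β' * hρ

theorem XRegularWith.abs_integral_sub_mul_le (hx : XRegularWith μ k β x₀ η C)
    (hv : HasContinuousVolume μ) (hβ : β.HolderConjugate β') (hη : 0 < η) (hC : 0 ≤ C)
    (hD : 0 ≤ D) (hs : 0 < vol μ x₀ s)
    (hf : ∀ y, |f y| ≤ D * invVol μ x₀ y ^ (1 / β'))
    (hf0 : ∀ y, vol μ x₀ (dist x₀ y) ≤ 2 * vol μ x₀ s → f y = 0)
    {x : M} (hxs : x ∈ closedBall x₀ s) :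
    |∫ y, (k x y - k x₀ y) * f y ∂μ| ≤ C * D * ((1 + η) / η * 2 ^ (-η)) := by
  set σ := vol μ x₀ s
  have hpoint (y : M) : ‖(k x y - k x₀ y) * f y‖ₑ ≤
      indicator {y | invVol μ x₀ y ≤ (2 * σ)⁻¹} (fun y =>
        ENNReal.ofReal (C * D * σ ^ η) * ENNReal.ofReal (invVol μ x₀ y ^ (1 + η))) y := by
    rcases le_or_gt (vol μ x₀ (dist x₀ y)) (2 * σ) with hy | hy
    · simp [hf0 y hy]
    · have hyT : y ∈ {y | invVol μ x₀ y ≤ (2 * σ)⁻¹} := inv_anti₀ (by positivity) hy.le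
      rw [indicator_of_mem hyT, ← ENNReal.ofReal_mul (by positivity), ← ofReal_norm]
      exact ENNReal.ofReal_le_ofReal (hx.abs_sub_mul_le hβ hC hs hxs hy (hf y))
  have hball : MeasurableSet {y | invVol μ x₀ y ≤ (2 * σ)⁻¹} :=
    measurableSet_le (hv.measurable_invVol x₀) measurable_const
  rw [← Real.norm_eq_abs]
  refine (norm_integral_le_lintegral_norm _).trans
    (ENNReal.toReal_le_of_le_ofReal (by positivity) ?_)
  calc _ ≤ ENNReal.ofReal (C * D * σ ^ η) *
          ENNReal.ofReal (1 * (1 + η) / (1 + η - 1) * (2 * σ)⁻¹ ^ (1 + η - 1)) := by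
        simp_rw [ofReal_norm]
        refine (lintegral_mono hpoint).trans ?_
        rw [lintegral_indicator hball, lintegral_const_mul' _ _ ENNReal.ofReal_ne_top]
        gcongr
        exact (hv.weakL1With_invVol x₀).setLIntegral_rpow_le_of_le zero_le_one
          (hv.measurable_invVol x₀) (invVol_nonneg x₀) (by linarith) (by positivity)
    _ = _ := by
        have hσ : σ ^ η * σ ^ (-η) = 1 := by
          rw [← Real.rpow_add hs, add_neg_cancel, Real.rpow_zero]
        rw [← ENNReal.ofReal_mul (by positivity), add_sub_cancel_left,
          Real.inv_rpow (by positivity), ← Real.rpow_neg (by positivity),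
          Real.mul_rpow zero_le_two hs.le]
        congr 1
        linear_combination C * D * ((1 + η) / η * 2 ^ (-η)) * hσ

theorem IsTaylorSystem.exists_cancelling_correction (hp : IsTaylorSystem μ x₀ p C)
    (hv : HasContinuousVolume μ) (hβ : β.HolderConjugate β') (hD : 0 ≤ D) (hr : 0 < vol μ x₀ r)
    (hfm : Measurable f) (hs : Function.support f ⊆ closedBall x₀ r)
    (hf : ∀ y, |f y| ≤ D * invVol μ x₀ y ^ (1 / β')) :
    ∃ b, Measurable b ∧ Function.support b ⊆ closedBall x₀ r ∧
      (∀ y, |b y| ≤ m * C ^ 2 * (D * β) * vol μ x₀ r ^ (-(1 / β'))) ∧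
      ∀ j, ∫ y, p j y * (f - b) y ∂μ = 0 := by
  set ρ := vol μ x₀ r
  have hβ0 := hβ.pos
  have hball : MeasurableSet (closedBall x₀ r) := isClosed_closedBall.measurableSet
  have hfE := hv.setLIntegral_enorm_le hβ hD hr (.of_forall hf)
  have hfL1 : ∫ y in closedBall x₀ r, |f y| ∂μ ≤ D * (β * ρ ^ (1 / β)) := by
    simp_rw [← Real.norm_eq_abs]
    rw [integral_norm_eq_lintegral_enorm hfm.aestronglyMeasurable]
    exact ENNReal.toReal_le_of_le_ofReal (by positivity) hfE
  have hρ : ρ ^ (1 / β) / ρ = ρ ^ (-(1 / β')) := by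
    rw [← Real.rpow_sub_one hr.ne']
    congr 1
    simp only [one_div]
    linarith [hβ.inv_add_inv_eq_one]
  obtain ⟨b, hbm, hb, hbp⟩ := hp.exists_moment_correction hv hr
    ⟨hfm.aestronglyMeasurable, hfE.trans_lt ENNReal.ofReal_lt_top⟩
  refine ⟨indicator (closedBall x₀ r) b, hbm.indicator hball, support_indicator_subset,
    fun y => ?_, fun j => ?_⟩
  · by_cases hy : y ∈ closedBall x₀ r
    · rw [indicator_of_mem hy]
      calc |b y| ≤ m * C ^ 2 * (D * (β * ρ ^ (1 / β)) / ρ) := (hb y hy).trans (by gcongr)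
        _ = m * C ^ 2 * (D * β) * (ρ ^ (1 / β) / ρ) := by ring
        _ = _ := by rw [hρ]
    · rw [indicator_of_notMem hy, abs_zero]
      positivity
  · rw [← hbp j, ← integral_indicator hball]
    congr with y
    rw [Pi.sub_apply]
    by_cases hy : y ∈ closedBall x₀ r
    · rw [indicator_of_mem hy, indicator_of_mem hy]
    · rw [indicator_of_notMem hy, indicator_of_notMem hy,
        Function.notMem_support.1 fun h => hy (hs h), sub_zero, mul_zero]

theorem XRegularWith.abs_potential_sub_sub_le (hx : XRegularWith μ k β x₀ η C)
    (hv : HasContinuousVolume μ) (hk : HasWeakType μ k β K) (hβ : β.HolderConjugate β')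
    (hη : 0 < η) (hC : 0 ≤ C) (hD : 0 ≤ D) (hE : 0 ≤ E) (hs : 0 < vol μ x₀ s)
    (hr : 0 < vol μ x₀ r) (hfi : ∀ x, Integrable (fun y => k x y * f y) μ)
    (hf : ∀ y, |f y| ≤ D * invVol μ x₀ y ^ (1 / β'))
    (hf0 : ∀ y, vol μ x₀ (dist x₀ y) ≤ 2 * vol μ x₀ s → f y = 0) (hbm : Measurable b)
    (hbs : Function.support b ⊆ closedBall x₀ r)
    (hb : ∀ y, |b y| ≤ E * vol μ x₀ r ^ (-(1 / β'))) {x : M} (hxs : x ∈ closedBall x₀ s) :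
    |potential μ k (f - b) x - potential μ k f x₀| ≤
      C * D * ((1 + η) / η * 2 ^ (-η)) + E * (1 + K / (β - 1)) := by
  have hbi := hk.integrable_mul hv hβ.lt hr hbm hbs hb
  have hsplit : potential μ k (f - b) x - potential μ k f x₀ =
      ∫ y, (k x y - k x₀ y) * f y ∂μ - potential μ k b x := by
    simp_rw [potential, Pi.sub_apply, mul_sub, sub_mul]
    rw [integral_sub (hfi x) (hbi x), integral_sub (hfi x) (hfi x₀)]
    ring
  rw [hsplit]
  exact (abs_sub _ _).trans (add_le_add (hx.abs_integral_sub_mul_le hv hβ hη hC hD hs hf hf0 hxs)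
    (hk.abs_potential_le hv hβ hE hr hbs hb x))

/-- Functions `f` on `B(x₀, r₂)` with `‖f‖_{β'}^{β'} ≤ I + C` whose potentials differ by at most
`C` from `I` on a ball of volume `V(r₁)/4`, where `I` is the integral of `|k(x₀,·)|^β` over the
annulus with radii `r₁`, `r₂`. -/
structure IsExtremalAtom (μ : Measure M) (k : M → M → ℝ) (β β' : ℝ) (x₀ : M)
    (p : Fin m → M → ℝ) (C r₁ r₂ : ℝ) (f : M → ℝ) : Prop where
  isCancellingAtom : IsCancellingAtom μ β' x₀ p C r₂ f
  normPow_le : normPow μ β' f ≤ annulusIntegral μ k β x₀ r₁ r₂ + ENNReal.ofReal C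
  abs_potential_sub_le : ∃ s, vol μ x₀ s = vol μ x₀ r₁ / 4 ∧ ∀ x ∈ closedBall x₀ s,
    |potential μ k f x - (annulusIntegral μ k β x₀ r₁ r₂).toReal| ≤ C

theorem exists_isExtremalAtom {C₁ B : ℝ} (hv : HasContinuousVolume μ) (hk : HasWeakType μ k β K)
    (hβ : β.HolderConjugate β') (hp : IsTaylorSystem μ x₀ p C) (hη : 0 < η) (hC₁ : 0 ≤ C₁)
    (hx : XRegularWith μ k β x₀ η C₁) (hB : 0 ≤ B) :
    ∃ C ≥ 0, ∀ r₁ r₂, 0 < vol μ x₀ r₁ → vol μ x₀ r₁ < vol μ x₀ r₂ →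
      (∀ y, r₁ ≤ dist x₀ y → dist x₀ y ≤ r₂ → |k x₀ y| ≤ B * invVol μ x₀ y ^ (1 / β)) →
      ∃ f, IsExtremalAtom μ k β β' x₀ p C r₁ r₂ f := by
  have := hβ.pos
  have := hβ.symm.pos
  have := hβ.sub_one_pos
  have := hk.nonneg
  set D := B ^ (β - 1)
  set E := m * C ^ 2 * (D * β)
  set c₁ := β' * 2 ^ (β' - 1) * (E * D ^ (β' - 1) * β' + E ^ β')
  set c₂ := C₁ * D * ((1 + η) / η * 2 ^ (-η))
  set c₃ := E * (1 + K / (β - 1))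
  have hD : 0 ≤ D := by positivity
  have hE : 0 ≤ E := by positivity
  have hc₁ : 0 ≤ c₁ := by positivity
  have hc₂ : 0 ≤ c₂ := by positivity
  have hc₃ : 0 ≤ c₃ := by positivity
  refine ⟨D + E + c₁ + c₂ + c₃, by positivity, fun r₁ r₂ hr₁ hr₁₂ hb => ?_⟩
  have hr₂ := hr₁.trans hr₁₂
  set g := dualDensity k β x₀ r₁ r₂
  have hgm : Measurable g := measurable_dualDensity hk.measurable β x₀ r₁ r₂
  have hgs : Function.support g ⊆ closedBall x₀ r₂ := support_dualDensity_subset k β x₀ r₁ r₂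
  have hgD : ∀ y, |g y| ≤ D * invVol μ x₀ y ^ (1 / β') := abs_dualDensity_le hβ hB hb
  obtain ⟨b, hbm, hbs, hbE, hbp⟩ := hp.exists_cancelling_correction hv hβ hD hr₂ hgm hgs hgD
  have hatom := hv.isCancellingAtom_sub hβ.symm.nonneg hE hgm hbm hgs hbs hgD hbE hbp
  obtain ⟨s, hs⟩ := hv.exists_vol_eq (x := x₀) (t := vol μ x₀ r₁ / 4) (r := r₁)
    (by linarith) (by linarith)
  refine ⟨g - b, hatom.mono (by linarith), ?_, s, hs, fun x hxs => ?_⟩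
  · rw [← normPow_dualDensity μ k hβ]
    refine (hv.normPow_sub_le hβ hD hE hr₂ hgm hatom.support_subset hgD hbE).trans ?_
    gcongr
    linarith
  · have hg0 (y : M) (hy : vol μ x₀ (dist x₀ y) ≤ 2 * vol μ x₀ s) : g y = 0 :=
      indicator_of_notMem (fun hyA => by linarith [hv.vol_mono x₀ hyA.1]) _
    have hgi := hk.integrable_mul hv hβ.lt hr₂ hgm hgs (abs_dualDensity_le_const hβ hB hv hr₁ hb)
    rw [← potential_dualDensity hk.measurable hβ.lt]
    refine (hx.abs_potential_sub_sub_le hv hk hβ hη hC₁ hD hE (by linarith) hr₂ hgi hgD hg0 hbm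
      hbs hbE hxs).trans ?_
    linarith

end Extremal

/-! ### Sharpness from extremal families -/

section Scaling

variable {α : Type*} [MeasurableSpace α] {μ : Measure α} {q N t : ℝ}

theorem potential_const_smul (k : α → α → ℝ) (a : ℝ) (f : α → ℝ) :
    potential μ k (a • f) = a • potential μ k f := by
  ext x
  simp_rw [potential, Pi.smul_apply, potential, mul_smul_comm]
  exact integral_smul a _

theorem normPow_rpow_smul (hN : 0 < N) (hq : 0 ≤ q) (t : ℝ) (g : α → ℝ) :
    normPow μ q (N ^ t • g) = ENNReal.ofReal (N ^ (t * q)) * normPow μ q g := by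
  rw [normPow, normPow, eLpNorm_const_smul, ENNReal.mul_rpow_of_nonneg _ _ hq,
    Real.enorm_of_nonneg (by positivity), ENNReal.ofReal_rpow_of_nonneg (by positivity) hq,
    ← Real.rpow_mul hN.le]

end Scaling

section LevelSet

variable {α : Type*} [MeasurableSpace α] {μ : Measure α} {β γ p C N : ℝ} {m : ℝ≥0∞} {u : α → ℝ}

/-- The function `|u|^β` takes values in `[N - C, N]` on a set of measure at least `m`. -/
def HasLevelSet (μ : Measure α) (β C N : ℝ) (m : ℝ≥0∞) (u : α → ℝ) : Prop :=
  ∃ S, MeasurableSet S ∧ m ≤ μ S ∧ ∀ x ∈ S, N - C ≤ |u x| ^ β ∧ |u x| ^ β ≤ N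

theorem HasLevelSet.mul_le_lintegral (hu : HasLevelSet μ β C N m u) {a : ℝ≥0∞} {F : ℝ → ℝ≥0∞}
    (hF : ∀ v, N - C ≤ |v| ^ β → |v| ^ β ≤ N → a ≤ F v) : a * m ≤ ∫⁻ x, F (u x) ∂μ := by
  obtain ⟨S, hS, hmS, hu⟩ := hu
  calc a * m ≤ a * μ S := by gcongr
    _ = ∫⁻ _ in S, a ∂μ := (setLIntegral_const S a).symm
    _ ≤ ∫⁻ x in S, F (u x) ∂μ := setLIntegral_mono' hS fun x hx => hF _ (hu x hx).1 (hu x hx).2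
    _ ≤ _ := setLIntegral_le_lintegral _ _

theorem HasLevelSet.normPow_pos (hu : HasLevelSet μ β C N m u) (hβ : 0 < β) (hp : 0 < p)
    (hm : 0 < m) (hN : C < N) : 0 < normPow μ p u := by
  rw [normPow_eq_lintegral μ hp]
  have hNC : 0 < N - C := sub_pos.2 hN
  refine lt_of_lt_of_le (ENNReal.mul_pos (a := ENNReal.ofReal ((N - C) ^ (1 / β)) ^ p)
    (ENNReal.rpow_pos (ENNReal.ofReal_pos.2 (by positivity)) ENNReal.ofReal_ne_top).ne' hm.ne')
    (hu.mul_le_lintegral (F := fun v => ‖v‖ₑ ^ p) fun v hv _ => ?_)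
  rw [← ofReal_norm, Real.norm_eq_abs]
  gcongr
  rwa [one_div, Real.rpow_inv_le_iff_of_pos hNC.le (abs_nonneg v) hβ]

theorem exists_half_exp_le_expReg (n : ℕ) : ∃ T : ℝ, ∀ t ≥ T, Real.exp t / 2 ≤ expReg n t := by
  have hsum : (fun t : ℝ => ∑ i ∈ Finset.range (n + 1), t ^ i / (i ! : ℝ)) =o[Filter.atTop]
      Real.exp := by
    refine Asymptotics.IsLittleO.fun_sum (A := fun (i : ℕ) (t : ℝ) => t ^ i / (i ! : ℝ))
      fun i _ => ?_
    simp_rw [div_eq_inv_mul]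
    exact Real.isLittleO_pow_exp_atTop.const_mul_left _
  obtain ⟨T, hT⟩ := Filter.eventually_atTop.1 (hsum.bound (c := 1 / 2) (by norm_num))
  refine ⟨T, fun t ht => ?_⟩
  have hle := (le_abs_self _).trans (hT t ht)
  rw [Real.norm_of_nonneg (Real.exp_pos t).le] at hle
  rw [expReg]
  linarith

theorem one_add_abs_rpow_le (hβ : 0 < β) (q : ℝ) {v : ℝ} (hv : 1 ≤ |v| ^ β) (hvN : |v| ^ β ≤ N) :
    1 + |v| ^ q ≤ 2 * N ^ (max q 0 / β) := by
  have hv1 : 1 ≤ |v| := by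
    contrapose! hv
    exact Real.rpow_lt_one (abs_nonneg v) hv hβ
  have hq : |v| ^ q ≤ N ^ (max q 0 / β) := by
    calc |v| ^ q ≤ |v| ^ max q 0 := Real.rpow_le_rpow_of_exponent_le hv1 (le_max_left _ _)
      _ = (|v| ^ β) ^ (max q 0 / β) := by
          rw [← Real.rpow_mul (abs_nonneg _), mul_div_cancel₀ _ hβ.ne']
      _ ≤ _ := Real.rpow_le_rpow (by positivity) hvN (by positivity)
  linarith [Real.one_le_rpow (hv.trans hvN) (z := max q 0 / β) (by positivity)]

theorem exists_eventually_mul_le_lintegral_expReg (hβ : 0 < β) (hγ : 0 < γ) (n : ℕ) (q C : ℝ) :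
    ∃ c > 0, ∀ᶠ N in Filter.atTop, ∀ (m : ℝ≥0∞) (u : α → ℝ), HasLevelSet μ β C N m u →
      ENNReal.ofReal (c * (Real.exp (γ * N) * N ^ (-(max q 0 / β)))) * m ≤
        ∫⁻ x, ENNReal.ofReal (expReg n (γ * |u x| ^ β) / (1 + |u x| ^ q)) ∂μ := by
  obtain ⟨T, hT⟩ := exists_half_exp_le_expReg n
  refine ⟨Real.exp (-(γ * C)) / 4, by positivity, ?_⟩
  filter_upwards [Filter.eventually_gt_atTop 0, Filter.eventually_ge_atTop (C + 1),
    Filter.eventually_ge_atTop (C + T / γ)] with N hN hNC hNT m u hu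
  refine hu.mul_le_lintegral
    (F := fun v => ENNReal.ofReal (expReg n (γ * |v| ^ β) / (1 + |v| ^ q)))
    fun v hv hvN => ENNReal.ofReal_le_ofReal ?_
  have hTv : T ≤ γ * |v| ^ β := by
    rw [← div_le_iff₀' hγ]
    linarith
  have hexp : Real.exp (γ * (N - C)) / 2 ≤ expReg n (γ * |v| ^ β) :=
    le_trans (by gcongr) (hT _ hTv)
  have hden : 1 + |v| ^ q ≤ 2 * N ^ (max q 0 / β) :=
    one_add_abs_rpow_le hβ q (by linarith) hvN
  calc _ = Real.exp (γ * (N - C)) / 2 / (2 * N ^ (max q 0 / β)) := by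
        rw [Real.rpow_neg hN.le, show γ * (N - C) = -(γ * C) + γ * N by ring, Real.exp_add]
        field_simp
        norm_num
    _ ≤ _ := div_le_div₀ (le_trans (by positivity) hexp) hexp (by positivity) hden

end LevelSet

section Extremals

variable {M : Type*} [MetricSpace M] [MeasurableSpace M] {μ : Measure M} {k : M → M → ℝ}
  {β β' γ p q κ A c C : ℝ} {I : Set ℝ}

/-- Admissible functions whose potential has size `N^{1/β}` on a set of measure at least
`c ρ e^{-N/A}`, and small `L^p` norm. -/
structure IsExtremal (μ : Measure M) (k : M → M → ℝ) (β β' p κ A c C N ρ : ℝ) (f : M → ℝ) :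
    Prop where
  pos : 0 < ρ
  admissible : Admissible μ k β' κ f
  normPow_le : normPow μ p (potential μ k f) ≤ ENNReal.ofReal (C * ρ * N ^ (-(p / β')))
  hasLevelSet : HasLevelSet μ β C N (ENNReal.ofReal (c * ρ * Real.exp (-(A⁻¹ * N))))
    (potential μ k f)

/-- Existence of extremal functions for arbitrarily large `N`, with constants independent of `N`
and volumes `ρ ∈ I`. -/
def HasExtremals (μ : Measure M) (k : M → M → ℝ) (β β' p κ A : ℝ) (I : Set ℝ) : Prop :=
  ∃ c > 0, ∃ C, ∃ᶠ N in Filter.atTop, ∃ ρ ∈ I, ∃ f, IsExtremal μ k β β' p κ A c C N ρ f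

theorem exists_eventually_isExtremal_imp (hβ : 0 < β) (hp : 0 < p) (hγ : 0 < γ) (hc : 0 < c)
    (n : ℕ) (q C : ℝ) :
    ∃ c' > 0, ∀ᶠ N in Filter.atTop, ∀ ρ f, IsExtremal μ k β β' p κ A c C N ρ f →
      0 < normPow μ p (potential μ k f) ∧
      ENNReal.ofReal (c' * ρ * (Real.exp ((γ - A⁻¹) * N) * N ^ (-(max q 0 / β)))) ≤
        ∫⁻ x, ENNReal.ofReal (expReg n (γ * |potential μ k f x| ^ β) /
          (1 + |potential μ k f x| ^ q)) ∂μ := by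
  obtain ⟨c₁, hc₁, hint⟩ := exists_eventually_mul_le_lintegral_expReg (μ := μ) hβ hγ n q C
  refine ⟨c₁ * c, by positivity, ?_⟩
  filter_upwards [hint, Filter.eventually_gt_atTop 0, Filter.eventually_gt_atTop C]
    with N hN hN0 hCN ρ f hf
  have := hf.pos
  refine ⟨hf.hasLevelSet.normPow_pos hβ hp (ENNReal.ofReal_pos.2 (by positivity)) hCN,
    le_trans (le_of_eq ?_) (hN _ _ hf.hasLevelSet)⟩
  rw [← ENNReal.ofReal_mul (by positivity),
    show (γ - A⁻¹) * N = γ * N + -(A⁻¹ * N) by ring, Real.exp_add]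
  congr 1
  ring

theorem tendsto_exp_mul_rpow_atTop {b : ℝ} (hb : 0 < b) (s : ℝ) :
    Filter.Tendsto (fun N : ℝ => Real.exp (b * N) * N ^ s) Filter.atTop Filter.atTop := by
  refine (tendsto_exp_mul_div_rpow_atTop (-s) b hb).congr' ?_
  filter_upwards [Filter.eventually_gt_atTop 0] with N hN
  rw [Real.rpow_neg hN.le, div_inv_eq_mul]

namespace HasExtremals

theorem exists_lt_growthIntegral (h : HasExtremals μ k β β' p κ A I) (hβ : 0 < β) (hp : 0 < p)
    (hγ : 0 < γ) (hlim : Filter.Tendsto (fun N : ℝ => Real.exp ((γ - A⁻¹) * N) *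
      N ^ (p / β' - max q 0 / β)) Filter.atTop Filter.atTop) (Λ : ℝ) :
    ∃ f, Admissible μ k β' κ f ∧ 0 < normPow μ p (potential μ k f) ∧
      normPow μ p (potential μ k f) < ∞ ∧
      ENNReal.ofReal Λ * normPow μ p (potential μ k f) < growthIntegral μ k β p γ q f := by
  obtain ⟨c, hc, C, hN⟩ := h
  obtain ⟨c', hc', hint⟩ := exists_eventually_isExtremal_imp (μ := μ) (k := k) (β' := β')
    (κ := κ) (A := A) hβ hp hγ hc ⌈p / β - 1⌉₊ q C
  obtain ⟨N, ⟨ρ, -, f, hf⟩, ⟨hint, hN0⟩, hlarge⟩ := (hN.and_eventually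
    ((hint.and (Filter.eventually_gt_atTop 0)).and
      (hlim.eventually_gt_atTop (|Λ| * C / c')))).exists
  have hρ := hf.pos
  refine ⟨f, hf.admissible, (hint ρ f hf).1, hf.normPow_le.trans_lt ENNReal.ofReal_lt_top,
    lt_of_lt_of_le ?_ (hint ρ f hf).2⟩
  calc _ ≤ ENNReal.ofReal |Λ| * ENNReal.ofReal (C * ρ * N ^ (-(p / β'))) := by
        gcongr
        exacts [le_abs_self Λ, hf.normPow_le]
    _ = ENNReal.ofReal (|Λ| * C * (ρ * N ^ (-(p / β')))) := by
        rw [← ENNReal.ofReal_mul (abs_nonneg _)]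
        congr 1
        ring
    _ < ENNReal.ofReal (Real.exp ((γ - A⁻¹) * N) * N ^ (p / β' - max q 0 / β) * c' *
          (ρ * N ^ (-(p / β')))) := by
        rw [ENNReal.ofReal_lt_ofReal_iff (by positivity)]
        rw [div_lt_iff₀ hc'] at hlarge
        gcongr
    _ = _ := by
        rw [show -(max q 0 / β) = (p / β' - max q 0 / β) + -(p / β') by ring, Real.rpow_add hN0]
        congr 1
        ring

theorem expConstantSharp (h : HasExtremals μ k β β' p κ A I) (hβ : 0 < β) (hp : 0 < p)
    (hA : 0 < A) : ExpConstantSharp μ k β β' p κ A⁻¹ := fun _ hγ Λ =>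
  h.exists_lt_growthIntegral hβ hp ((inv_pos.2 hA).trans hγ)
    (tendsto_exp_mul_rpow_atTop (sub_pos.2 hγ) _) Λ

theorem denominatorPowerSharp (h : HasExtremals μ k β β' p κ A I) (hβ : β.HolderConjugate β')
    (hp : 0 < p) (hA : 0 < A) : DenominatorPowerSharp μ k β β' p κ A⁻¹ := by
  intro q hq Λ
  refine h.exists_lt_growthIntegral hβ.pos hp (inv_pos.2 hA) ?_ Λ
  have hexp : 0 < p / β' - max q 0 / β := by
    rw [sub_pos, div_lt_iff₀ hβ.pos, div_mul_eq_mul_div]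
    exact max_lt hq (div_pos (mul_pos hp hβ.pos) hβ.symm.pos)
  simpa using tendsto_rpow_atTop hexp

theorem expConstantStronglySharp {ρ₀ : ℝ} (h : HasExtremals μ k β β' p κ A {ρ₀})
    (hβ : β.HolderConjugate β') (hp : 0 < p) (hA : 0 < A) :
    ExpConstantStronglySharp μ k β β' p κ A⁻¹ := by
  intro γ hγ Λ ε hε
  obtain ⟨c, hc, C, hN⟩ := h
  obtain ⟨c', hc', hint⟩ := exists_eventually_isExtremal_imp (μ := μ) (k := k) (β' := β')
    (κ := κ) (A := A) hβ.pos hp ((inv_pos.2 hA).trans hγ) hc ⌈p / β - 1⌉₊ (p * β / β') C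
  have hlarge := (tendsto_exp_mul_rpow_atTop (sub_pos.2 hγ)
    (-(max (p * β / β') 0 / β))).eventually_gt_atTop (|Λ| / (c' * ρ₀))
  have hsmall : ∀ᶠ N : ℝ in Filter.atTop, C * ρ₀ * N ^ (-(p / β')) < ε := by
    have hlim := (tendsto_rpow_neg_atTop (div_pos hp hβ.symm.pos)).const_mul (C * ρ₀)
    rw [mul_zero] at hlim
    exact hlim.eventually_lt_const hε
  obtain ⟨N, ⟨ρ, rfl, f, hf⟩, hint, hlarge, hsmall⟩ :=
    (hN.and_eventually (hint.and (hlarge.and hsmall))).exists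
  have hρ := hf.pos
  rw [div_lt_iff₀' (by positivity)] at hlarge
  refine ⟨f, hf.admissible, (hint ρ f hf).1,
    hf.normPow_le.trans_lt ((ENNReal.ofReal_lt_ofReal_iff hε).2 hsmall),
    lt_of_lt_of_le ?_ (hint ρ f hf).2⟩
  rw [ENNReal.ofReal_lt_ofReal_iff ((abs_nonneg Λ).trans_lt hlarge)]
  exact (le_abs_self Λ).trans_lt hlarge

theorem rufConstantSharp {ρ₀ : ℝ} (h : HasExtremals μ k β β' p κ A {ρ₀}) (hβ : 0 < β)
    (hp : 0 < p) (hA : 0 < A) : RufConstantSharp μ k β β' κ A⁻¹ := by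
  intro γ hγ Λ
  obtain ⟨c, hc, C, hN⟩ := h
  obtain ⟨c', hc', hint⟩ := exists_eventually_isExtremal_imp (μ := μ) (k := k) (β' := β')
    (κ := κ) (A := A) hβ hp ((inv_pos.2 hA).trans hγ) hc ⌈β' - 2⌉₊ 0 C
  have hlarge := (tendsto_exp_mul_rpow_atTop (sub_pos.2 hγ)
    (-(max 0 0 / β))).eventually_gt_atTop (|Λ| / (c' * ρ₀))
  obtain ⟨N, ⟨ρ, rfl, f, hf⟩, hint, hlarge⟩ := (hN.and_eventually (hint.and hlarge)).exists
  have hρ := hf.pos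
  rw [div_lt_iff₀' (by positivity)] at hlarge
  refine ⟨f, hf.admissible, ?_⟩
  calc ENNReal.ofReal Λ < _ := by
        rw [ENNReal.ofReal_lt_ofReal_iff ((abs_nonneg Λ).trans_lt hlarge)]
        exact (le_abs_self Λ).trans_lt hlarge
    _ ≤ _ := (hint ρ f hf).2
    _ ≤ _ := lintegral_mono fun x => by
        rw [ENNReal.ofReal_div_of_pos (by positivity)]
        refine ENNReal.div_le_of_le_mul (le_mul_of_one_le_right' ?_)
        simp

end HasExtremals

end Extremals

/-! ### Extremal families for proper kernels -/

section Proper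

variable {M : Type*} [MetricSpace M] [MeasurableSpace M] {μ : Measure M} {k : M → M → ℝ}
  {β β' p κ η η₁ A B C K N a r₁ r₂ : ℝ} {x₀ : M} {f : M → ℝ} {I : Set ℝ}

/-- Functions supported in `B(x₀, r₂)` that become extremal after normalization: their norms are
controlled by, and their potentials near `x₀` are close to, the integral of `|k(x₀,·)|^β` over the
annulus with radii `r₁`, `r₂`. -/
structure IsTestFunction (μ : Measure M) (k : M → M → ℝ) (β β' p κ : ℝ) (x₀ : M)
    (C r₁ r₂ : ℝ) (f : M → ℝ) : Prop where
  measurable : Measurable f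
  support_subset : Function.support f ⊆ closedBall x₀ r₂
  normPow_add_le : normPow μ β' f + ENNReal.ofReal κ * normPow μ β' (potential μ k f) ≤
    ENNReal.ofReal ((annulusIntegral μ k β x₀ r₁ r₂).toReal + C)
  normPow_potential_le : normPow μ p (potential μ k f) ≤ ENNReal.ofReal (C * vol μ x₀ r₂)
  abs_potential_sub_le : ∃ s, vol μ x₀ s = vol μ x₀ r₁ / 4 ∧ ∀ x ∈ closedBall x₀ s,
    |potential μ k f x - (annulusIntegral μ k β x₀ r₁ r₂).toReal| ≤ C

/-- Annuli on which `|k(x₀,·)|^β` is at most `B^β / V` and has integral at least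
`A log (V(r₂) / V(r₁)) - C`. -/
structure IsProperAnnulus (μ : Measure M) (k : M → M → ℝ) (β A B C : ℝ) (x₀ : M) (r₁ r₂ : ℝ) :
    Prop where
  pos : 0 < vol μ x₀ r₁
  lt : vol μ x₀ r₁ < vol μ x₀ r₂
  abs_le : ∀ y, r₁ ≤ dist x₀ y → dist x₀ y ≤ r₂ → |k x₀ y| ≤ B * invVol μ x₀ y ^ (1 / β)
  le_annulusIntegral : ENNReal.ofReal (A * Real.log (vol μ x₀ r₂ / vol μ x₀ r₁) - C) ≤
    annulusIntegral μ k β x₀ r₁ r₂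

/-- The pointwise bound `|k(x₀, y)| ≤ B V(d(x₀, y))^{-1/β}` for volumes in `s`. -/
def HasSizeAt (μ : Measure M) (k : M → M → ℝ) (β : ℝ) (x₀ : M) (s : Set ℝ) : Prop :=
  ∃ B ≥ 0, ∀ y, vol μ x₀ (dist x₀ y) ∈ s → |k x₀ y| ≤ B * invVol μ x₀ y ^ (1 / β)

theorem admissible_rpow_smul (hβ : 0 < β') (hN : 0 < N) (hf : Measurable f)
    (hs : Function.support f ⊆ closedBall x₀ r₂)
    (hfN : normPow μ β' f + ENNReal.ofReal κ * normPow μ β' (potential μ k f) ≤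
      ENNReal.ofReal N) :
    Admissible μ k β' κ (N ^ (-(1 / β')) • f) := by
  refine ⟨hf.const_smul _, ⟨x₀, r₂, (Function.support_const_smul_subset _ f).trans hs⟩, ?_⟩
  rw [potential_const_smul, normPow_rpow_smul hN hβ.le, normPow_rpow_smul hN hβ.le, neg_mul,
    one_div_mul_cancel hβ.ne', Real.rpow_neg_one, mul_left_comm, ← mul_add]
  calc _ ≤ ENNReal.ofReal N⁻¹ * ENNReal.ofReal N := by gcongr
    _ = 1 := by
        rw [← ENNReal.ofReal_mul (by positivity), inv_mul_cancel₀ hN.ne', ENNReal.ofReal_one]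

theorem rpow_neg_mul_rpow_mem_Icc (hβ : β.HolderConjugate β') {c u : ℝ} (hN : 0 < N)
    (hcN : c ≤ N) (hl : N - c ≤ u) (hu : u ≤ N) :
    |N ^ (-(1 / β')) * u| ^ β ∈ Icc (N - β * c) N := by
  have hβ0 := hβ.pos
  have hu0 : 0 ≤ u := by linarith
  have hexp : -(1 / β') * β = 1 - β := by
    rw [one_div, eq_sub_of_add_eq' hβ.inv_add_inv_eq_one]
    linear_combination mul_inv_cancel₀ hβ.ne_zero
  have heq : |N ^ (-(1 / β')) * u| ^ β = N * (u / N) ^ β := by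
    rw [abs_of_nonneg (by positivity), Real.mul_rpow (by positivity) hu0, ← Real.rpow_mul hN.le,
      hexp, Real.div_rpow hu0 hN.le, Real.rpow_sub hN, Real.rpow_one]
    ring
  rw [heq]
  constructor
  · have hbernoulli := one_add_mul_self_le_rpow_one_add (s := u / N - 1)
      (by linarith [show 0 ≤ u / N by positivity]) hβ.lt.le
    rw [add_sub_cancel] at hbernoulli
    calc N - β * c ≤ N - β * (N - u) := by gcongr; linarith
      _ = N * (1 + β * (u / N - 1)) := by field_simp; ring
      _ ≤ _ := by gcongr
  · exact mul_le_of_le_one_right hN.le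
      (Real.rpow_le_one (by positivity) ((div_le_one hN).2 hu) hβ0.le)

theorem mul_exp_neg_le_of_mul_log_le {v ρ : ℝ} (hA : 0 < A) (hv : 0 < v) (hρ : 0 < ρ)
    (h : A * Real.log (ρ / v) - C ≤ N) :
    Real.exp (-(A⁻¹ * C)) * ρ * Real.exp (-(A⁻¹ * N)) ≤ v := by
  have hlog : Real.log (ρ / v) ≤ A⁻¹ * (N + C) := by
    rw [← div_eq_inv_mul, le_div_iff₀' hA]
    linarith
  rw [Real.log_le_iff_le_exp (by positivity), div_le_iff₀ hv] at hlog
  calc _ = ρ * Real.exp (-(A⁻¹ * (N + C))) := by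
        rw [mul_add, neg_add, Real.exp_add]
        ring
    _ ≤ Real.exp (A⁻¹ * (N + C)) * v * Real.exp (-(A⁻¹ * (N + C))) := by gcongr
    _ = v := by
        rw [mul_right_comm, ← Real.exp_add, add_neg_cancel, Real.exp_zero, one_mul]

section OpensMeasurableSpace

variable [OpensMeasurableSpace M]

theorem IsTestFunction.isExtremal (hf : IsTestFunction μ k β β' p κ x₀ C r₁ r₂ f)
    (hv : HasContinuousVolume μ) (hβ : β.HolderConjugate β') (hp : 0 < p) (hA : 0 < A)
    {C_A : ℝ} (hr : IsProperAnnulus μ k β A B C_A x₀ r₁ r₂) (hC : 0 ≤ C)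
    (hN : N = (annulusIntegral μ k β x₀ r₁ r₂).toReal + C)
    (hI : annulusIntegral μ k β x₀ r₁ r₂ ≠ ∞) (hCN : 2 * C < N) :
    IsExtremal μ k β β' p κ A (Real.exp (-(A⁻¹ * C_A)) / 4) (C + β * (2 * C)) N (vol μ x₀ r₂)
      (N ^ (-(1 / β')) • f) := by
  have hβ0 := hβ.pos
  have hN0 : 0 < N := by linarith
  have hr₂ := hr.pos.trans hr.lt
  refine ⟨hr₂, admissible_rpow_smul hβ.symm.pos hN0 hf.measurable hf.support_subset
    (hN ▸ hf.normPow_add_le), ?_, ?_⟩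
  · rw [potential_const_smul, normPow_rpow_smul hN0 hp.le, mul_comm,
      show -(1 / β') * p = -(p / β') by ring]
    rw [ENNReal.ofReal_mul (by positivity)]
    gcongr
    refine hf.normPow_potential_le.trans (ENNReal.ofReal_le_ofReal ?_)
    gcongr
    exact le_add_of_nonneg_right (by positivity)
  · obtain ⟨s, hs, hfs⟩ := hf.abs_potential_sub_le
    refine ⟨closedBall x₀ s, isClosed_closedBall.measurableSet, ?_, fun x hx => ?_⟩
    · rw [← hv.ofReal_vol, hs]
      refine ENNReal.ofReal_le_ofReal ?_
      have hlog := (ENNReal.ofReal_le_iff_le_toReal hI).1 hr.le_annulusIntegral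
      rw [div_mul_eq_mul_div, div_mul_eq_mul_div]
      gcongr
      exact mul_exp_neg_le_of_mul_log_le hA hr.pos hr₂ (by linarith)
    · rw [potential_const_smul, Pi.smul_apply, smul_eq_mul]
      have hfx := abs_le.1 (hfs x hx)
      have hmem := rpow_neg_mul_rpow_mem_Icc hβ hN0 hCN.le (u := potential μ k f x)
        (by linarith) (by linarith)
      exact ⟨by linarith [hmem.1], hmem.2⟩

theorem IsCancellingAtom.exists_mul_normPow_potential_le {m : ℕ} {C_P C_T : ℝ}
    {P T : Fin m → M → ℝ} (hv : HasContinuousVolume μ) (hk : HasWeakType μ k β K)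
    (hβ : β.HolderConjugate β') (hP : IsTaylorSystem μ x₀ P C_P) (hC_T : 0 ≤ C_T)
    (hT : TaylorRemainderLe μ k β x₀ η T P C_T) (hC : 0 ≤ C)
    (hκ : κ = 0 ∨ 1 < (η + 1 / β) * β' ∧ BddAbove I) :
    ∃ C' ≥ 0, ∀ r, 0 < vol μ x₀ r → vol μ x₀ r ∈ I → ∀ f, IsCancellingAtom μ β' x₀ P C r f →
      ENNReal.ofReal κ * normPow μ β' (potential μ k f) ≤ ENNReal.ofReal C' := by
  rcases hκ with rfl | ⟨hβη, ρ, hρ⟩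
  · exact ⟨0, le_rfl, by simp⟩
  · obtain ⟨C', hC', hfβ⟩ := IsCancellingAtom.exists_normPow_potential_le hv hk hβ hP hC_T hT hC
      hβ.symm.pos hβη
    refine ⟨|κ| * (C' * |ρ|), by positivity, fun r hr hrI f hf => ?_⟩
    rw [ENNReal.ofReal_mul (abs_nonneg κ)]
    gcongr
    · exact le_abs_self κ
    · refine (hfβ r hr f hf).trans (ENNReal.ofReal_le_ofReal ?_)
      gcongr
      exact (hρ hrI).trans (le_abs_self ρ)

theorem exists_isTestFunction (hv : HasContinuousVolume μ) (hk : HasWeakType μ k β K)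
    (hβ : β.HolderConjugate β') (hη₁ : 0 < η₁) (hη : 0 ≤ η) (hx : IsXRegularAt μ k β x₀ η₁)
    (hy : HasTaylorFormulaAt μ k β x₀ η) (hp : 0 < p) (hpη : 1 < (η + 1 / β) * p)
    (hκ : κ = 0 ∨ 1 < (η + 1 / β) * β' ∧ BddAbove I) (hB : 0 ≤ B) :
    ∃ C ≥ 0, ∀ A C_A r₁ r₂, IsProperAnnulus μ k β A B C_A x₀ r₁ r₂ → vol μ x₀ r₂ ∈ I →
      ∃ f, IsTestFunction μ k β β' p κ x₀ C r₁ r₂ f := by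
  obtain ⟨m, T, P, C_P, C_T, hP, hC_T, hT⟩ := hy.exists_isTaylorSystem hv hη
  obtain ⟨C_x, hC_x, hx⟩ := hx.exists_xRegularWith hv hη₁.le
  obtain ⟨C, hC, hatom⟩ := exists_isExtremalAtom hv hk hβ hP hη₁ hC_x hx hB
  obtain ⟨C_p, hC_p, hfp⟩ := IsCancellingAtom.exists_normPow_potential_le hv hk hβ hP hC_T hT hC
    hp hpη
  obtain ⟨C_κ, hC_κ, hfκ⟩ := IsCancellingAtom.exists_mul_normPow_potential_le hv hk hβ hP hC_T hT
    hC hκ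
  refine ⟨C + C_p + C_κ, by positivity, fun A C_A r₁ r₂ hr hrI => ?_⟩
  have hr₂ := hr.pos.trans hr.lt
  obtain ⟨f, hf⟩ := hatom r₁ r₂ hr.pos hr.lt hr.abs_le
  have hI := hv.annulusIntegral_ne_top hβ.nonneg hr.pos hr.abs_le
  obtain ⟨s, hs, hfs⟩ := hf.abs_potential_sub_le
  refine ⟨f, hf.isCancellingAtom.measurable, hf.isCancellingAtom.support_subset, ?_, ?_,
    s, hs, fun x hxs => (hfs x hxs).trans (by linarith)⟩
  · calc _ ≤ annulusIntegral μ k β x₀ r₁ r₂ + ENNReal.ofReal C + ENNReal.ofReal C_κ :=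
          add_le_add hf.normPow_le (hfκ r₂ hr₂ hrI f hf.isCancellingAtom)
      _ = ENNReal.ofReal ((annulusIntegral μ k β x₀ r₁ r₂).toReal + C + C_κ) := by
          rw [ENNReal.ofReal_add (by positivity) hC_κ, ENNReal.ofReal_add (by positivity) hC,
            ENNReal.ofReal_toReal hI]
      _ ≤ _ := ENNReal.ofReal_le_ofReal (by linarith)
  · refine (hfp r₂ hr₂ f hf.isCancellingAtom).trans (ENNReal.ofReal_le_ofReal ?_)
    gcongr
    linarith

theorem hasExtremals_of_isProperAnnulus (hv : HasContinuousVolume μ) (hk : HasWeakType μ k β K)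
    (hβ : β.HolderConjugate β') (hη₁ : 0 < η₁) (hη : 0 ≤ η) (hx : IsXRegularAt μ k β x₀ η₁)
    (hy : HasTaylorFormulaAt μ k β x₀ η) (hp : 0 < p) (hpη : 1 < (η + 1 / β) * p)
    (hκ : κ = 0 ∨ 1 < (η + 1 / β) * β' ∧ BddAbove I) (hA : 0 < A) (hB : 0 ≤ B)
    (hann : ∀ Λ, ∃ r₁ r₂, IsProperAnnulus μ k β A B C x₀ r₁ r₂ ∧ vol μ x₀ r₂ ∈ I ∧
      Λ ≤ Real.log (vol μ x₀ r₂ / vol μ x₀ r₁)) :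
    HasExtremals μ k β β' p κ A I := by
  obtain ⟨C', hC', htest⟩ := exists_isTestFunction hv hk hβ hη₁ hη hx hy hp hpη hκ hB
  refine ⟨Real.exp (-(A⁻¹ * C)) / 4, by positivity, C' + β * (2 * C'),
    Filter.frequently_atTop.2 fun N₀ => ?_⟩
  obtain ⟨r₁, r₂, hr, hrI, hlog⟩ := hann (A⁻¹ * (max N₀ (C' + 1) + C))
  obtain ⟨f, hf⟩ := htest A C r₁ r₂ hr hrI
  have hI := hv.annulusIntegral_ne_top hβ.nonneg hr.pos hr.abs_le
  have hL := (ENNReal.ofReal_le_iff_le_toReal hI).1 hr.le_annulusIntegral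
  rw [← div_eq_inv_mul, div_le_iff₀' hA] at hlog
  have hN₀ := le_max_left N₀ (C' + 1)
  have hC'L := le_max_right N₀ (C' + 1)
  exact ⟨_, by linarith, _, hrI, _, hf.isExtremal hv hβ hp hA hr hC' rfl hI (by linarith)⟩

theorem IsProperOnDiagonalAt.hasExtremals (h : IsProperOnDiagonalAt μ k β A x₀) (hμ : μ ≠ 0)
    (hv : HasContinuousVolume μ) (hk : HasWeakType μ k β K) (hsize : HasSizeAt μ k β x₀ (Ioc 0 1))
    (hβ : β.HolderConjugate β') (hη₁ : 0 < η₁) (hη : 0 ≤ η) (hx : IsXRegularAt μ k β x₀ η₁)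
    (hy : HasTaylorFormulaAt μ k β x₀ η) (hp : 0 < p) (hpη : 1 < (η + 1 / β) * p)
    (hκ : κ = 0 ∨ 1 < (η + 1 / β) * β') (hA : 0 < A) :
    ∃ ρ, HasExtremals μ k β β' p κ A {ρ} := by
  obtain ⟨C, hC⟩ := h
  obtain ⟨B, hB, hb⟩ := hsize
  obtain ⟨r, hr⟩ := hv.exists_lt_vol x₀ (c := 0) (by
    simpa using (Measure.measure_univ_ne_zero.2 hμ).bot_lt)
  obtain ⟨r₂, hr₂⟩ := hv.exists_vol_eq (x := x₀) (t := min 1 (vol μ x₀ r)) (r := r)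
    (lt_min one_pos hr).le (min_le_right _ _)
  have hρ1 : vol μ x₀ r₂ ≤ 1 := hr₂ ▸ min_le_left _ _
  have hρ0 : 0 < vol μ x₀ r₂ := hr₂ ▸ lt_min one_pos hr
  refine ⟨vol μ x₀ r₂, hasExtremals_of_isProperAnnulus hv hk hβ hη₁ hη hx hy hp hpη
    (hκ.imp_right fun h => ⟨h, bddAbove_singleton⟩) hA hB (C := C) fun Λ => ?_⟩
  have hlt : vol μ x₀ r₂ * Real.exp (-max Λ 1) < vol μ x₀ r₂ :=
    mul_lt_of_lt_one_right hρ0 (by simp)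
  obtain ⟨r₁, hr₁⟩ := hv.exists_vol_eq (x := x₀) (by positivity) hlt.le
  have hpos : 0 < vol μ x₀ r₁ := by rw [hr₁]; positivity
  refine ⟨r₁, r₂, ⟨hpos, hr₁ ▸ hlt, fun y hy₁ hy₂ => hb y ⟨hpos.trans_le (hv.vol_mono x₀ hy₁),
    (hv.vol_mono x₀ hy₂).trans hρ1⟩, hC r₁ r₂ hpos (hr₁ ▸ hlt) hρ1⟩, mem_singleton _, ?_⟩
  rw [hr₁, div_mul_cancel_left₀ hρ0.ne', Real.exp_neg, inv_inv, Real.log_exp]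
  exact le_max_left _ _

theorem IsProperAtInfinityAt.hasExtremals (h : IsProperAtInfinityAt μ k β A x₀)
    (hv : HasContinuousVolume μ) (hk : HasWeakType μ k β K) (hsize : HasSizeAt μ k β x₀ (Ici 1))
    (hβ : β.HolderConjugate β') (hη₁ : 0 < η₁) (hη : 0 ≤ η) (hx : IsXRegularAt μ k β x₀ η₁)
    (hy : HasTaylorFormulaAt μ k β x₀ η) (hp : 0 < p) (hpη : 1 < (η + 1 / β) * p) :
    HasExtremals μ k β β' p 0 A univ := by
  obtain ⟨htop, hA, C, hC⟩ := h
  obtain ⟨B, hB, hb⟩ := hsize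
  have hvol (t : ℝ) (ht : 0 ≤ t) : ∃ r, vol μ x₀ r = t := by
    obtain ⟨r, hr⟩ := hv.exists_lt_vol x₀ (c := t) (by rw [htop]; exact ENNReal.ofReal_lt_top)
    exact hv.exists_vol_eq ht hr.le
  refine hasExtremals_of_isProperAnnulus hv hk hβ hη₁ hη hx hy hp hpη (.inl rfl) hA hB
    (C := C) fun Λ => ?_
  obtain ⟨r₁, hr₁⟩ := hvol 1 zero_le_one
  obtain ⟨r₂, hr₂⟩ := hvol (Real.exp (max Λ 1)) (Real.exp_pos _).le
  have hlt : vol μ x₀ r₁ < vol μ x₀ r₂ := by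
    rw [hr₁, hr₂, Real.one_lt_exp_iff]
    exact lt_max_of_lt_right one_pos
  refine ⟨r₁, r₂, ⟨hr₁ ▸ one_pos, hlt, fun y hy₁ _ => hb y (hr₁.ge.trans (hv.vol_mono x₀ hy₁)),
    hC r₁ r₂ hr₁.ge hlt⟩, mem_univ _, ?_⟩
  rw [hr₁, hr₂, div_one, Real.log_exp]
  exact le_max_left _ _

end OpensMeasurableSpace

theorem PointwiseBoundNear.hasSizeAt (h : PointwiseBoundNear μ k β B) (hB : 0 ≤ B) (x₀ : M) :
    HasSizeAt μ k β x₀ (Ioc 0 1) := by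
  refine ⟨B, hB, fun y hy => ?_⟩
  rw [invVol, Real.inv_rpow hy.1.le, ← Real.rpow_neg hy.1.le]
  exact h x₀ y hy.1 hy.2

theorem PointwiseBound.hasSizeAt (h : PointwiseBound μ k β B) (hB : 0 ≤ B) (x₀ : M) :
    HasSizeAt μ k β x₀ (Ioi 0) := by
  refine ⟨B, hB, fun y hy => ?_⟩
  rw [mem_Ioi] at hy
  rw [invVol, Real.inv_rpow hy.le, ← Real.rpow_neg hy.le]
  exact (h x₀ y).1 hy

theorem HasSizeAt.mono {s t : Set ℝ} (h : HasSizeAt μ k β x₀ t) (hst : s ⊆ t) :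
    HasSizeAt μ k β x₀ s :=
  h.imp fun _ hB => ⟨hB.1, fun y hy => hB.2 y (hst hy)⟩

theorem one_lt_add_one_div_mul (hβ : β.HolderConjugate β') (hη : 0 ≤ η) {q : ℝ}
    (h : (1 + q / β') * (1 + η)⁻¹ < q) : 1 < (η + 1 / β) * q := by
  rw [← div_eq_mul_inv, div_lt_iff₀ (by linarith)] at h
  linear_combination h - q * hβ.inv_add_inv_eq_one

theorem exists_hasWeakType_and_hasSizeAt {A₀ Ainf : ℝ} (hv : HasContinuousVolume μ)
    (hk : IsRieszLike μ k β A₀ Ainf ∨ Ainf = 0 ∧ IsCriticalRieszLike μ k β A₀) (x₀ : M) :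
    ∃ K, HasWeakType μ k β K ∧ HasSizeAt μ k β x₀ (Ioc 0 1) ∧
      (0 < Ainf → HasSizeAt μ k β x₀ (Ici 1)) := by
  rcases hk with hk | ⟨rfl, hk⟩
  · obtain ⟨K, hK⟩ := hk.exists_hasWeakType hv
    obtain ⟨B, hB, -, -, hb⟩ := hk.size
    have hsize := hb.hasSizeAt hB x₀
    exact ⟨K, hK, hsize.mono Ioc_subset_Ioi_self, fun _ => hsize.mono (Ici_subset_Ioi.2 one_pos)⟩
  · obtain ⟨K, hK⟩ := hk.exists_hasWeakType
    obtain ⟨B, hB, -, -, hb⟩ := hk.size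
    exact ⟨K, hK, hb.hasSizeAt hB x₀, fun h => absurd h (lt_irrefl 0)⟩

end Proper

end RieszLike

end

theorem theorem2_general {M : Type*} [MetricSpace M] [MeasurableSpace M] [OpensMeasurableSpace M]
    (μ : Measure M) (hμ : μ ≠ 0) (hvol : RieszLike.HasContinuousVolume μ)
    (k : M → M → ℝ) (β β' A₀ Ainf p K : ℝ) (hβ : β.HolderConjugate β')
    (hk : RieszLike.HasWeakType μ k β K) (hA₀ : 0 < A₀)
    (x₀ : M) (η₁ η : ℝ) (hη₁ : 0 < η₁) (hη : 0 ≤ η)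
    (hx : RieszLike.IsXRegularAt μ k β x₀ η₁)
    (hy : RieszLike.HasTaylorFormulaAt μ k β x₀ η)
    (hpη : (1 + p / β') * (1 + η)⁻¹ < p) :
    (RieszLike.HasSizeAt μ k β x₀ (Ioc 0 1) → RieszLike.IsProperOnDiagonalAt μ k β A₀ x₀ →
      ∀ κ : ℝ, 0 ≤ κ → (κ = 0 ∨ (1 + β' / β') * (1 + η)⁻¹ < β') →
        RieszLike.ExpConstantStronglySharp μ k β β' p κ A₀⁻¹ ∧
        RieszLike.DenominatorPowerSharp μ k β β' p κ A₀⁻¹ ∧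
        RieszLike.RufConstantSharp μ k β β' κ A₀⁻¹) ∧
    (RieszLike.HasSizeAt μ k β x₀ (Ici 1) → RieszLike.IsProperAtInfinityAt μ k β Ainf x₀ →
      RieszLike.ExpConstantSharp μ k β β' p 0 Ainf⁻¹ ∧
      RieszLike.DenominatorPowerSharp μ k β β' p 0 Ainf⁻¹) := by
  have hpη' := RieszLike.one_lt_add_one_div_mul hβ hη hpη
  have hp : 0 < p :=
    (pos_iff_pos_of_mul_pos (one_pos.trans hpη')).1 (add_pos_of_nonneg_of_pos hη hβ.one_div_pos)
  refine ⟨fun hsize h κ _ hκ => ?_, fun hsize h => ?_⟩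
  · obtain ⟨ρ, hρ⟩ := h.hasExtremals hμ hvol hk hsize hβ hη₁ hη hx hy hp hpη'
      (hκ.imp_right (RieszLike.one_lt_add_one_div_mul hβ hη)) hA₀
    exact ⟨hρ.expConstantStronglySharp hβ hp hA₀, hρ.denominatorPowerSharp hβ hp hA₀,
      hρ.rufConstantSharp hβ.pos hp hA₀⟩
  · have hext := h.hasExtremals hvol hk hsize hβ hη₁ hη hx hy hp hpη'
    exact ⟨hext.expConstantSharp hβ.pos hp h.2.1, hext.denominatorPowerSharp hβ hp h.2.1⟩

theorem theorem2 {M : Type*} [MetricSpace M] [MeasurableSpace M] [BorelSpace M]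
    (μ : MeasureTheory.Measure M) (hμ : μ ≠ 0) (hvol : RieszLike.HasContinuousVolume μ)
    (k : M → M → ℝ) (β β' A₀ Ainf p : ℝ) (hβ : β.HolderConjugate β') (hp : 1 ≤ p)
    (hk : RieszLike.IsRieszLike μ k β A₀ Ainf ∨
      (Ainf = 0 ∧ RieszLike.IsCriticalRieszLike μ k β A₀))
    (x₀ : M) (η₁ η : ℝ) (hη₁ : 0 < η₁) (hη : 0 ≤ η)
    (hx : RieszLike.IsXRegularAt μ k β x₀ η₁)
    (hy : RieszLike.HasTaylorFormulaAt μ k β x₀ η)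
    (hpη : (1 + p / β') * (1 + η)⁻¹ < p) :
    (RieszLike.IsProperOnDiagonalAt μ k β A₀ x₀ →
      (Ainf ≤ A₀ →
        RieszLike.ExpConstantStronglySharp μ k β β' p 0 (max A₀ Ainf)⁻¹ ∧
        RieszLike.DenominatorPowerSharp μ k β β' p 0 (max A₀ Ainf)⁻¹) ∧
      (∀ κ : ℝ, 0 ≤ κ → (κ = 0 ∨ (1 + β' / β') * (1 + η)⁻¹ < β') →
        RieszLike.ExpConstantStronglySharp μ k β β' p κ A₀⁻¹ ∧
        RieszLike.DenominatorPowerSharp μ k β β' p κ A₀⁻¹ ∧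
        RieszLike.RufConstantSharp μ k β β' κ A₀⁻¹)) ∧
    (RieszLike.IsProperAtInfinityAt μ k β Ainf x₀ → A₀ ≤ Ainf →
      RieszLike.ExpConstantSharp μ k β β' p 0 (max A₀ Ainf)⁻¹ ∧
      RieszLike.DenominatorPowerSharp μ k β β' p 0 (max A₀ Ainf)⁻¹) := by
  obtain ⟨K, hK, hnear, hfar⟩ := RieszLike.exists_hasWeakType_and_hasSizeAt hvol hk x₀
  obtain ⟨hdiag, hinf⟩ := theorem2_general μ hμ hvol k β β' A₀ Ainf p K hβ hK
    (hk.elim (·.A₀_pos) (·.2.A₀_pos)) x₀ η₁ η hη₁ hη hx hy hpη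
  refine ⟨fun h => ⟨fun hA => ?_, hdiag hnear h⟩, fun h hA => ?_⟩
  · rw [max_eq_left hA]
    obtain ⟨hexp, hpow, -⟩ := hdiag hnear h 0 le_rfl (.inl rfl)
    exact ⟨hexp, hpow⟩
  · rw [max_eq_right hA]
    exact hinf (hfar h.2.1) h
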